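/- A permuton is a Borel probability measure $\gamma$ on the unit square $[0,1]^2$ whose two marginals are both Lebesgue measure on $[0,1]$. The space $\Gamma$ of permutons carries the weak topology. For a permutation $\pi$ of $\{1,\dots,n\}$, $n\ge 1$, let $\gamma_\pi$ be the permuton whose density equals $n$ on each square $\left(\frac{i-1}{n},\frac{i}{n}\right]\times\left(\frac{\pi(i)-1}{n},\frac{\pi(i)}{n}\right]$, $1\le i\le n$, and $0$ elsewhere. The entropy of a permuton $\gamma$ with density $g$ is $$H(\gamma)=\int_{[0,1]^2}-g(x,y)\log g(x,y)\,dx\,dy\in[-\infty,0]\qquad(0\log 0=0),$$ and $H(\gamma)=-\infty$ if $\gamma$ has no density. **Theorem (large deviations principle for permutons).** Let $\Lambda\subseteq\Gamma$, and for $n\ge1$ let $\Lambda_n$ be the set of permutations $\pi\in S_n$ with $\gamma_\pi\in\Lambda$. 1. If $\Lambda$ is closed, then $$\limsup_{n\to\infty}\frac1n\log\frac{|\Lambda_n|}{n!}\le\sup_{\gamma\in\Lambda}H(\gamma).$$ 2. If $\Lambda$ is open, then $$\liminf_{n\to\infty}\frac1n\log\frac{|\Lambda_n|}{n!}\ge\sup_{\gamma\in\Lambda}H(\gamma).$$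 Here $\log 0=-\infty$ and $\sup\emptyset=-\infty$. -/

import Mathlib

open MeasureTheory Filter unitInterval
open scoped ENNReal Nat

noncomputable section

/-- A permuton: a probability measure on the unit square `[0,1]²` both of whose marginals are
Lebesgue measure on `[0,1]`.  As a subtype of `ProbabilityMeasure (I × I)` the space of permutons
carries the weak topology (convergence of integrals of continuous functions). -/
abbrev Permuton : Type :=
  {γ : ProbabilityMeasure (I × I) //
    (γ : Measure (I × I)).fst = volume ∧ (γ : Measure (I × I)).snd = volume}

namespace Permuton

/-- The interval `(i/n, (i+1)/n]` in `[0,1]`, for `i = 0, …, n-1`. -/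
def cell (n : ℕ) (i : Fin n) : Set I :=
  {x | (i : ℝ) / n < x ∧ (x : ℝ) ≤ ((i : ℝ) + 1) / n}

/-- The measure on the unit square with density `n` on each of the squares
`cell n i ×ˢ cell n (π i)` and density `0` elsewhere. -/
def permMeasure {n : ℕ} (π : Equiv.Perm (Fin n)) : Measure (I × I) :=
  ∑ i, (n : ℝ≥0∞) • (volume : Measure (I × I)).restrict (cell n i ×ˢ cell n (π i))

lemma cell_eq_Ioc (n : ℕ) (i : Fin n) :
    ∃ a b : I, (a : ℝ) = (i : ℝ) / n ∧ (b : ℝ) = ((i : ℝ) + 1) / n ∧ cell n i = Set.Ioc a b := by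
  have hn : (0 : ℝ) < n := by exact_mod_cast i.pos
  have hi : (i : ℝ) + 1 ≤ n := by exact_mod_cast i.isLt
  refine ⟨⟨(i : ℝ) / n, by positivity, (div_le_one hn).2 (by linarith)⟩,
    ⟨((i : ℝ) + 1) / n, by positivity, (div_le_one hn).2 hi⟩, rfl, rfl, ?_⟩
  ext x
  simp [cell, ← Subtype.coe_lt_coe, ← Subtype.coe_le_coe]

lemma measurableSet_cell (n : ℕ) (i : Fin n) : MeasurableSet (cell n i) := by
  obtain ⟨a, b, -, -, h⟩ := cell_eq_Ioc n i
  rw [h]; exact measurableSet_Ioc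

lemma volume_cell (n : ℕ) (i : Fin n) : volume (cell n i) = (n : ℝ≥0∞)⁻¹ := by
  have hn : (0 : ℝ) < n := by exact_mod_cast i.pos
  obtain ⟨a, b, ha, hb, h⟩ := cell_eq_Ioc n i
  rw [h, unitInterval.volume_Ioc, ha, hb]
  have : ((i : ℝ) + 1) / n - (i : ℝ) / n = (n : ℝ)⁻¹ := by field_simp; ring
  rw [this, ENNReal.ofReal_inv_of_pos hn, ENNReal.ofReal_natCast]

lemma pairwise_disjoint_cell (n : ℕ) :
    Pairwise (Function.onFun Disjoint (cell n)) := by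
  intro i j hij
  have hn : (0 : ℝ) < n := by exact_mod_cast i.pos
  refine Set.disjoint_left.2 fun x hx hy => hij ?_
  have h1 : (i : ℝ) < (j : ℝ) + 1 := by
    have := hx.1.trans_le hy.2
    rwa [div_lt_div_iff_of_pos_right hn] at this
  have h2 : (j : ℝ) < (i : ℝ) + 1 := by
    have := hy.1.trans_le hx.2
    rwa [div_lt_div_iff_of_pos_right hn] at this
  norm_cast at h1 h2
  exact Fin.ext (by omega)

lemma sum_restrict_cell {n : ℕ} (hn : n ≠ 0) :
    ∑ i : Fin n, (volume : Measure I).restrict (cell n i) = volume := by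
  rw [← Measure.sum_fintype, ← Measure.restrict_iUnion (pairwise_disjoint_cell n)
    (measurableSet_cell n)]
  refine Measure.restrict_eq_self_of_ae_mem ?_
  have hm : MeasurableSet (⋃ i, cell n i) := MeasurableSet.iUnion (measurableSet_cell n)
  have h1 : volume (⋃ i, cell n i) = 1 := by
    rw [measure_iUnion (pairwise_disjoint_cell n) (measurableSet_cell n)]
    simp only [volume_cell, tsum_fintype, Finset.sum_const, Finset.card_univ, Fintype.card_fin,
      nsmul_eq_mul]
    exact ENNReal.mul_inv_cancel (by exact_mod_cast hn) (ENNReal.natCast_ne_top n)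
  exact (prob_compl_eq_zero_iff hm).2 h1

lemma permMeasure_apply {n : ℕ} (π : Equiv.Perm (Fin n)) {s t : Set I} (hs : MeasurableSet s)
    (ht : MeasurableSet t) :
    permMeasure π (s ×ˢ t) =
      ∑ i, (n : ℝ≥0∞) * (volume (s ∩ cell n i) * volume (t ∩ cell n (π i))) := by
  simp only [permMeasure, Measure.finsetSum_apply, Measure.smul_apply, smul_eq_mul]
  refine Finset.sum_congr rfl fun i _ => ?_
  rw [Measure.restrict_apply (hs.prod ht), Set.prod_inter_prod, Measure.volume_eq_prod,
    Measure.prod_prod]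

lemma sum_volume_inter_cell {n : ℕ} (hn : n ≠ 0) {s : Set I} (hs : MeasurableSet s) :
    ∑ i : Fin n, volume (s ∩ cell n i) = volume s := by
  conv_rhs => rw [← sum_restrict_cell hn]
  simp only [Measure.finsetSum_apply, Measure.restrict_apply hs]

lemma fst_permMeasure {n : ℕ} (hn : n ≠ 0) (π : Equiv.Perm (Fin n)) :
    (permMeasure π).fst = volume := by
  ext s hs
  rw [Measure.fst_apply hs, ← Set.prod_univ, permMeasure_apply π hs MeasurableSet.univ,
    ← sum_volume_inter_cell hn hs]
  refine Finset.sum_congr rfl fun i _ => ?_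
  rw [Set.univ_inter, volume_cell, mul_left_comm,
    ENNReal.mul_inv_cancel (by exact_mod_cast hn) (ENNReal.natCast_ne_top n), mul_one]

lemma snd_permMeasure {n : ℕ} (hn : n ≠ 0) (π : Equiv.Perm (Fin n)) :
    (permMeasure π).snd = volume := by
  ext s hs
  rw [Measure.snd_apply hs, ← Set.univ_prod, permMeasure_apply π MeasurableSet.univ hs,
    ← sum_volume_inter_cell hn hs,
    ← Equiv.sum_comp π (fun i => volume (s ∩ cell n i))]
  refine Finset.sum_congr rfl fun i _ => ?_
  rw [Set.univ_inter, volume_cell, ← mul_assoc,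
    ENNReal.mul_inv_cancel (by exact_mod_cast hn) (ENNReal.natCast_ne_top n), one_mul]

/-- The permuton `γ_π` of a permutation `π` of `n ≥ 1` points. -/
def ofPerm {n : ℕ} (hn : n ≠ 0) (π : Equiv.Perm (Fin n)) : Permuton :=
  ⟨⟨permMeasure π, ⟨by
      rw [← Measure.fst_univ, fst_permMeasure hn]; exact measure_univ⟩⟩,
    fst_permMeasure hn π, snd_permMeasure hn π⟩

open scoped Classical in
/-- The entropy `H(γ) = ∫ -g log g` over the unit square, where `g` is the density of `γ`
(`Real.negMulLog z = -z * log z`, with value `0` at `0`), as an extended real; it is `-∞` if `γ`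
has no density.  Since `-z log z ≤ 1`, the integral is `-∞` when `-g log g` is not integrable. -/
def entropy (γ : Permuton) : EReal :=
  let g : I × I → ℝ := fun p => ((γ.1 : Measure (I × I)).rnDeriv volume p).toReal
  if (γ.1 : Measure (I × I)) ≪ volume ∧ Integrable (fun p => Real.negMulLog (g p)) volume
  then ((∫ p, Real.negMulLog (g p) : ℝ) : EReal)
  else ⊥

/-- `Λ_n`: the permutations `π` of `n` points (`n ≥ 1`) with `γ_π ∈ Λ`. -/
def permsIn (Λ : Set Permuton) (n : ℕ) : Set (Equiv.Perm (Fin n)) :=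
  {π | ∃ hn : n ≠ 0, ofPerm hn π ∈ Λ}

/-- `(1/n) log (|Λ_n| / n!)`, as an extended real, with `log 0 = -∞`. -/
def logRate (Λ : Set Permuton) (n : ℕ) : EReal :=
  ((1 / (n : ℝ) : ℝ) : EReal) *
    ENNReal.log (((permsIn Λ n).ncard : ℝ≥0∞) / (n ! : ℝ≥0∞))

end Permuton

end

/-!
Fix `m` and cut the unit square into the `m²` squares of the `m`-grid. The argument compares three
quantities: the number of permutations with a given number of points in each block of the grid, the
entropy of a permuton discretized to the grid (`gridEntropy`), and the entropy itself.

*Counting.* Permutations with the same block counts `N i j` form one orbit of the product of the two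
Young subgroups of the row and column blocks, so there are exactly
`∏ kᵢ! ∏ kⱼ! / ∏ N i j!` of them, where `kᵢ` is the size of the `i`-th block
(`card_blockCount_mul`). By Stirling's formula this number, divided by `n!`, is `exp (n H + o(n))`
uniformly in the permutation, `H` being the grid entropy of its permuton
(`eventually_log_card_blockClass`).

*Grid entropy and entropy.* Jensen's inequality gives `H(γ) ≤ gridEntropy γ m`
(`entropy_le_gridEntropy`). Conversely `H(γ)` is the infimum of the grid entropies
(`exists_gridEntropy_lt`): the relative entropy of `γ` with respect to Lebesgue measure is the
supremum of `∫ u dγ + 1 - ∫ e^u` over bounded measurable `u`, where `u` may be replaced by a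
continuous function, hence by one that is almost constant on the squares of a fine grid, and for
these the functional is controlled by the grid entropy. The case of a permuton without density, or
with `g log g` not integrable, is covered as well: then the functional is unbounded.

*Upper bound.* The masses of the squares, hence the grid entropy, are continuous on the space of
permutons, because the boundaries of the squares are null sets. So each `γ` with `H(γ) < c` has the
neighbourhood `{gridEntropy · m < c}` for some `m`. It contains at most `n! exp (c n + o(n))`
permutations, as there are only polynomially many block counts. As the space of permutons is
compact, finitely many of these neighbourhoods cover a closed set (`rateLE_of_isClosed`).

*Lower bound.* An open set containing `γ` contains all permutons whose masses on some grid are close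
to those of `γ` (`exists_grid_subset_of_isOpen`). For every large `n` some permutation has block
counts within `O(1)` of `n` times these masses (`exists_perm_blockCount_near`), and its whole class
lies in the open set (`eventually_le_logRate`).
-/

namespace Permuton

/-! ### Counting permutations by their block counts -/

section Counting

variable {α ι κ : Type*} [Fintype α] [DecidableEq ι] [DecidableEq κ]

/-- The number of points `(a, π a)` of the graph of `π` in the block `(i, j)`, when rows are sorted
into blocks by `r` and columns by `s`. -/
def blockCount (r : α → ι) (s : α → κ) (π : Equiv.Perm α) (i : ι) (j : κ) : ℕ :=
  (Finset.univ.filter fun a => r a = i ∧ s (π a) = j).card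

/-- The number of elements of the block `i` of the partition into fibres of `r`. -/
def blockSize (r : α → ι) (i : ι) : ℕ :=
  (Finset.univ.filter fun a => r a = i).card

lemma sum_blockSize [Fintype ι] (r : α → ι) : ∑ i, blockSize r i = Fintype.card α :=
  (Finset.card_eq_sum_card_fiberwise (by simp)).symm

lemma blockSize_le (r : α → ι) (i : ι) : blockSize r i ≤ Fintype.card α :=
  Finset.card_filter_le _ _

lemma blockCount_eq_blockSize (r : α → ι) (s : α → κ) (π : Equiv.Perm α) (i : ι) (j : κ) :
    blockCount r s π i j = blockSize (fun a => (r a, s (π a))) (i, j) := by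
  simp [blockCount, blockSize, Prod.ext_iff]

lemma sum_blockCount [Fintype ι] [Fintype κ] (r : α → ι) (s : α → κ) (π : Equiv.Perm α) :
    ∑ i, ∑ j, blockCount r s π i j = Fintype.card α := by
  simp_rw [blockCount_eq_blockSize]
  rw [← Fintype.sum_prod_type', sum_blockSize]

lemma card_stabilizer [DecidableEq α] [Fintype ι] (f : α → ι) :
    Fintype.card {ρ : Equiv.Perm α // f ∘ ρ = f} = ∏ i, (blockSize f i)! := by
  rw [DomMulAct.stabilizer_card]
  simp [blockSize, Fintype.card_subtype]

lemma blockSize_comp_perm (f : α → ι) (ρ : Equiv.Perm α) : blockSize (f ∘ ρ) = blockSize f := by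
  funext i
  refine Finset.card_bij (fun a _ => ρ a) (by simp) (by simp)
    fun b hb => ⟨ρ.symm b, by simpa using hb⟩

lemma exists_perm_comp_eq {f g : α → ι} (h : blockSize f = blockSize g) :
    ∃ ρ : Equiv.Perm α, f ∘ ρ = g := by
  have e : ∀ i, Nonempty ({a // g a = i} ≃ {a // f a = i}) := fun i => by
    rw [← Fintype.card_eq, Fintype.card_subtype, Fintype.card_subtype]
    exact (congrFun h i).symm
  refine ⟨Equiv.ofFiberEquiv fun i => (e i).some, funext fun a => ?_⟩
  exact Equiv.ofFiberEquiv_map _ a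

/-- The permutations carrying one colouring to another with the same class sizes form a coset of
the stabilizer of the first; with different class sizes there are none. -/
lemma card_comp_eq [DecidableEq α] [Fintype ι] (f g : α → ι) :
    Fintype.card {ρ : Equiv.Perm α // f ∘ ρ = g} =
      if blockSize g = blockSize f then ∏ i, (blockSize f i)! else 0 := by
  split_ifs with h
  · obtain ⟨τ, rfl⟩ := exists_perm_comp_eq h.symm
    rw [← card_stabilizer]
    refine Fintype.card_congr ((Equiv.mulRight τ⁻¹).subtypeEquiv fun ρ => ?_)
    simp only [Equiv.coe_mulRight, Equiv.Perm.coe_mul, ← Function.comp_assoc]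
    constructor
    · intro h; rw [h, Function.comp_assoc, ← Equiv.Perm.coe_mul]; simp
    · intro h
      conv_rhs => rw [← h]
      rw [Function.comp_assoc, ← Equiv.Perm.coe_mul]; simp
  · rw [Fintype.card_eq_zero_iff]
    refine ⟨fun ⟨ρ, hρ⟩ => h ?_⟩
    rw [← hρ, blockSize_comp_perm]

/-- The permutations with prescribed block counts form an orbit of the product of the two
stabilizers (of `r` and of `s`), and the stabilizer of a point of this orbit permutes the points of
the graph inside each block. This is the orbit–stabilizer formula. -/
theorem card_blockCount_mul [DecidableEq α] [Fintype ι] [Fintype κ] (r : α → ι) (s : α → κ)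
    (π₀ : Equiv.Perm α) :
    (Finset.univ.filter fun π => blockCount r s π = blockCount r s π₀).card *
        ∏ i, ∏ j, (blockCount r s π₀ i j)! =
      (∏ i, (blockSize r i)!) * ∏ j, (blockSize s j)! := by
  let c : Equiv.Perm α → α → ι × κ := fun π a => (r a, s (π a))
  -- Both sides count the pairs `(π, ρ)` with `c π₀ ∘ ρ = c π`, where `π = τ * π₀ * ρ`.
  have key : Fintype.card (Σ π, {ρ : Equiv.Perm α // c π₀ ∘ ρ = c π}) =
      Fintype.card ({ρ : Equiv.Perm α // r ∘ ρ = r} × {τ : Equiv.Perm α // s ∘ τ = s}) := by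
    have hc : ∀ ρ π : Equiv.Perm α, c π₀ ∘ ρ = c π ↔ r ∘ ρ = r ∧ s ∘ (π * ρ⁻¹ * π₀⁻¹) = s := by
      intro ρ π
      simp only [c, funext_iff, Function.comp_apply, Prod.mk.injEq, forall_and]
      refine and_congr_right fun _ => ⟨fun h a => ?_, fun h a => ?_⟩
      · have := h (ρ⁻¹ (π₀⁻¹ a)); simp at this; simp [this]
      · have := h (π₀ (ρ a)); simp at this; simp [this]
    refine Fintype.card_congr
      { toFun := fun x => (⟨x.2.1, ((hc _ _).1 x.2.2).1⟩, ⟨_, ((hc _ _).1 x.2.2).2⟩)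
        invFun := fun y => ⟨y.2.1 * π₀ * y.1.1, y.1.1, (hc _ _).2 ⟨y.1.2, by
          simpa using y.2.2⟩⟩
        left_inv := ?_
        right_inv := fun y => by ext <;> simp }
    rintro ⟨π, ρ, h⟩
    have h1 : π * ρ⁻¹ * π₀⁻¹ * π₀ * ρ = π := by group
    simp only
    ext1
    · exact h1
    · rfl
  have hb : ∀ π, blockSize (c π) = blockSize (c π₀) ↔ blockCount r s π = blockCount r s π₀ := by
    intro π
    simp only [funext_iff, blockCount_eq_blockSize, Prod.forall]
    rfl
  rw [Fintype.card_sigma, Fintype.card_prod, card_stabilizer, card_stabilizer] at key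
  rw [← key]
  simp_rw [card_comp_eq, hb]
  rw [← Finset.sum_filter, Finset.sum_const, smul_eq_mul, Fintype.prod_prod_type]
  simp only [blockCount_eq_blockSize]
  rfl

end Counting

/-! ### Stirling's approximation -/

lemma abs_log_factorial_sub_le {k n : ℕ} (hkn : k ≤ n) :
    |Real.log (k ! : ℝ) - (k * Real.log k - k)| ≤ 1 + Real.log n := by
  rcases Nat.eq_zero_or_pos k with rfl | hk
  · simpa using add_nonneg zero_le_one (Real.log_natCast_nonneg n)
  have hlog : Real.log k ≤ Real.log n := Real.log_le_log (by positivity) (by exact_mod_cast hkn)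
  have hlog0 := Real.log_natCast_nonneg k
  have h1 := Stirling.le_log_factorial_stirling hk.ne'
  have h2 : 0 ≤ Real.log (2 * Real.pi) :=
    Real.log_nonneg (by nlinarith [Real.pi_gt_three])
  have h3 := Stirling.log_stirlingSeq_formula k
  have h4 : Real.log (Stirling.stirlingSeq k) ≤ Real.log (Stirling.stirlingSeq 1) := by
    have := Stirling.log_stirlingSeq'_antitone (Nat.zero_le (k - 1))
    simpa [Nat.succ_eq_add_one, Nat.sub_add_cancel hk] using this
  have h5 := Stirling.log_stirlingSeq_formula 1
  have hk0 : (k : ℝ) ≠ 0 := by positivity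
  rw [Real.log_mul (by norm_num) hk0, Real.log_div hk0 (Real.exp_ne_zero _), Real.log_exp] at h3
  rw [Stirling.stirlingSeq_one] at h4
  simp at h5
  rw [abs_le]
  constructor <;> nlinarith

lemma abs_log_factorial_add_negMulLog_le {k n : ℕ} (hn : n ≠ 0) (hkn : k ≤ n) :
    |Real.log (k ! : ℝ) - (k * Real.log n - k - n * Real.negMulLog (k / n))| ≤ 1 + Real.log n := by
  convert abs_log_factorial_sub_le hkn using 2
  have hn' : (n : ℝ) ≠ 0 := by exact_mod_cast hn
  rcases Nat.eq_zero_or_pos k with rfl | hk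
  · simp
  · have hk0 : (k : ℝ) ≠ 0 := by positivity
    rw [Real.negMulLog, Real.log_div hk0 hn']
    field_simp
    ring

/-! ### Comparing a permutation with the coarse grid -/

/-- The index `i` of the cell of the `m`-grid with `i/m ≤ a/n < (i+1)/m`. The cell of width `1/n`
at `a` may stick out of it by less than its own width. -/
def blockOf (m : ℕ) [NeZero m] {n : ℕ} (a : Fin n) : Fin m :=
  ⟨a * m / n, (Nat.div_lt_iff_lt_mul a.pos).2 (by
    rw [mul_comm m n]; exact Nat.mul_lt_mul_of_pos_right a.isLt (NeZero.pos m))⟩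

/-- The fraction of the cell `a` of the `n`-grid that lies in the cell `i` of the `m`-grid. -/
noncomputable def overlap {m n : ℕ} (i : Fin m) (a : Fin n) : ℝ :=
  n * volume.real (cell m i ∩ cell n a)

lemma volume_real_cell (n : ℕ) (i : Fin n) : volume.real (cell n i) = (n : ℝ)⁻¹ := by
  simp [measureReal_def, volume_cell]

lemma overlap_nonneg {m n : ℕ} (i : Fin m) (a : Fin n) : 0 ≤ overlap i a := by
  unfold overlap; positivity

lemma overlap_le_one {m n : ℕ} (i : Fin m) (a : Fin n) : overlap i a ≤ 1 := by
  have hn : (0 : ℝ) < n := by exact_mod_cast a.pos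
  calc overlap i a ≤ n * volume.real (cell n a) := by
        unfold overlap; gcongr
        · exact measure_ne_top _ _
        · exact Set.inter_subset_right
    _ = 1 := by rw [volume_real_cell]; field_simp

lemma sum_overlap {m n : ℕ} (hn : n ≠ 0) (i : Fin m) : ∑ a : Fin n, overlap i a = n / m := by
  have h := congrArg ENNReal.toReal (sum_volume_inter_cell hn (measurableSet_cell m i))
  rw [ENNReal.toReal_sum (fun _ _ => measure_ne_top _ _)] at h
  simp only [overlap, ← Finset.mul_sum, measureReal_def, h, volume_cell]
  simp [div_eq_mul_inv]

lemma abs_overlap_sub_le {m : ℕ} [NeZero m] {n : ℕ} (i : Fin m) (a : Fin n) :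
    |overlap i a - (if blockOf m a = i then 1 else 0)| ≤
      (if (a : ℕ) = i * n / m then 1 else 0) + (if (a : ℕ) = (i + 1) * n / m then 1 else 0) := by
  have hn : (0 : ℝ) < n := by exact_mod_cast a.pos
  have hm : (0 : ℝ) < m := by exact_mod_cast NeZero.pos m
  have hb : blockOf m a = i ↔ i * n ≤ a * m ∧ a * m < (i + 1) * n := by
    rw [Fin.ext_iff, blockOf, Nat.div_eq_iff a.pos, add_mul, one_mul]
    have := a.pos
    constructor <;> rintro ⟨h1, h2⟩ <;> constructor <;> omega
  have hrhs : (0 : ℝ) ≤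
      (if (a : ℕ) = i * n / m then 1 else 0) + (if (a : ℕ) = (i + 1) * n / m then 1 else 0) := by
    split_ifs <;> norm_num
  have hdiv : ∀ k : ℕ, a * m ≤ k → k < (a + 1) * m → (a : ℕ) = k / m := fun k h1 h2 =>
    ((Nat.div_eq_iff (NeZero.pos m)).2 ⟨h1, by
      have := NeZero.pos m; rw [add_mul, one_mul] at h2; omega⟩).symm
  by_cases h1 : (i + 1) * n ≤ a * m
  · have h0 : overlap i a = 0 := by
      have : cell m i ∩ cell n a = ∅ := by
        refine Set.disjoint_iff_inter_eq_empty.1 (Set.disjoint_left.2 fun x hx hy => ?_)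
        have hlt := hy.1.trans_le hx.2
        rw [div_lt_div_iff₀ hn hm] at hlt
        exact absurd h1 (not_le.2 (by exact_mod_cast hlt))
      simp [overlap, this]
    rw [h0, if_neg (by rw [hb]; omega)]
    simpa using hrhs
  by_cases h2 : (a + 1) * m ≤ i * n
  · have h0 : overlap i a = 0 := by
      have : cell m i ∩ cell n a = ∅ := by
        refine Set.disjoint_iff_inter_eq_empty.1 (Set.disjoint_left.2 fun x hx hy => ?_)
        have hlt := hx.1.trans_le hy.2
        rw [div_lt_div_iff₀ hm hn] at hlt
        exact absurd h2 (not_le.2 (by exact_mod_cast hlt))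
      simp [overlap, this]
    rw [h0, if_neg (by rw [hb]; rw [add_mul, one_mul] at h2; have := NeZero.pos m; omega)]
    simpa using hrhs
  push Not at h1 h2
  by_cases h3 : i * n ≤ a * m
  · by_cases h4 : (a + 1) * m ≤ (i + 1) * n
    · have h0 : overlap i a = 1 := by
        have : cell m i ∩ cell n a = cell n a := by
          refine Set.inter_eq_right.2 fun x hx => ⟨lt_of_le_of_lt ?_ hx.1, hx.2.trans ?_⟩
          · rw [div_le_div_iff₀ hm hn]; exact_mod_cast h3
          · rw [div_le_div_iff₀ hn hm]; exact_mod_cast h4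
        rw [overlap, this, volume_real_cell]; field_simp
      rw [h0, if_pos (hb.2 ⟨h3, h1⟩)]
      simpa using hrhs
    · have h5 := hdiv _ h1.le (not_le.1 h4)
      rw [if_pos (hb.2 ⟨h3, h1⟩), if_pos h5, abs_le]
      have := overlap_nonneg i a
      have := overlap_le_one i a
      split_ifs <;> constructor <;> linarith
  · have h5 := hdiv _ (not_le.1 h3).le h2
    rw [if_neg (by rw [hb]; tauto), if_pos h5, abs_le]
    have := overlap_nonneg i a
    have := overlap_le_one i a
    split_ifs <;> constructor <;> linarith

lemma sum_abs_overlap_sub_le {m : ℕ} [NeZero m] {n : ℕ} (i : Fin m) :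
    ∑ a : Fin n, |overlap i a - (if blockOf m a = i then 1 else 0)| ≤ 2 := by
  have hle : ∀ k : ℕ, ∑ a : Fin n, (if (a : ℕ) = k then (1 : ℝ) else 0) ≤ 1 := fun k => by
    rw [Finset.sum_boole]
    have : (Finset.univ.filter fun a : Fin n => (a : ℕ) = k).card ≤ 1 :=
      Finset.card_le_one.2 fun a ha b hb => Fin.ext (by simp at ha hb; omega)
    exact_mod_cast this
  refine (Finset.sum_le_sum fun a _ => abs_overlap_sub_le i a).trans ?_
  rw [Finset.sum_add_distrib]
  linarith [hle (i * n / m), hle ((i + 1) * n / m)]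

lemma abs_blockSize_sub_le {m : ℕ} [NeZero m] {n : ℕ} (hn : n ≠ 0) (i : Fin m) :
    |(blockSize (blockOf m (n := n)) i : ℝ) - n / m| ≤ 2 := by
  rw [← sum_overlap hn i, abs_sub_comm, blockSize, ← Finset.sum_boole, ← Finset.sum_sub_distrib]
  exact (Finset.abs_sum_le_sum_abs _ _).trans (sum_abs_overlap_sub_le i)

lemma permMeasure_real_cell {m n : ℕ} (π : Equiv.Perm (Fin n)) (i j : Fin m) :
    (permMeasure π).real (cell m i ×ˢ cell m j) =
      (∑ a, overlap i a * overlap j (π a)) / n := by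
  rw [measureReal_def, permMeasure_apply π (measurableSet_cell m i) (measurableSet_cell m j),
    ENNReal.toReal_sum, Finset.sum_div]
  · refine Finset.sum_congr rfl fun a _ => ?_
    have hn : (n : ℝ) ≠ 0 := by exact_mod_cast a.pos.ne'
    simp only [overlap, measureReal_def, ENNReal.toReal_mul, ENNReal.toReal_natCast]
    field_simp
  · intro a _
    exact ENNReal.mul_ne_top (ENNReal.natCast_ne_top n)
      (ENNReal.mul_ne_top (measure_ne_top _ _) (measure_ne_top _ _))

/-- The mass that `γ_π` gives to a square of the `m`-grid is, up to `4/n`, the proportion of the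
graph of `π` in the corresponding block: only the at most two cells of width `1/n` per row block
and per column block that straddle a grid line contribute to the difference. -/
lemma abs_permMeasure_real_cell_sub_le {m : ℕ} [NeZero m] {n : ℕ} (π : Equiv.Perm (Fin n))
    (i j : Fin m) :
    |(permMeasure π).real (cell m i ×ˢ cell m j) -
      blockCount (blockOf m) (blockOf m) π i j / n| ≤ 4 / n := by
  rw [permMeasure_real_cell, ← sub_div, abs_div, Nat.abs_cast]
  gcongr
  rw [blockCount, ← Finset.sum_boole, ← Finset.sum_sub_distrib]
  refine (Finset.abs_sum_le_sum_abs _ _).trans ?_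
  have hterm : ∀ a : Fin n,
      |overlap i a * overlap j (π a) -
        (if blockOf m a = i ∧ blockOf m (π a) = j then (1 : ℝ) else 0)| ≤
      |overlap i a - (if blockOf m a = i then 1 else 0)| +
        |overlap j (π a) - (if blockOf m (π a) = j then 1 else 0)| := by
    intro a
    have e : (if blockOf m a = i ∧ blockOf m (π a) = j then (1 : ℝ) else 0) =
        (if blockOf m a = i then 1 else 0) * (if blockOf m (π a) = j then 1 else 0) := by
      by_cases h1 : blockOf m a = i <;> by_cases h2 : blockOf m (π a) = j <;> simp [h1, h2]
    rw [e]
    generalize hu : (if blockOf m a = i then (1 : ℝ) else 0) = u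
    generalize hv : (if blockOf m (π a) = j then (1 : ℝ) else 0) = v
    have hu1 : |u| ≤ 1 := by rw [← hu]; split_ifs <;> simp
    have hw1 : |overlap j (π a)| ≤ 1 := by
      rw [abs_of_nonneg (overlap_nonneg _ _)]; exact overlap_le_one _ _
    calc |overlap i a * overlap j (π a) - u * v|
        = |(overlap i a - u) * overlap j (π a) + u * (overlap j (π a) - v)| := by ring_nf
      _ ≤ |(overlap i a - u) * overlap j (π a)| + |u * (overlap j (π a) - v)| := abs_add_le _ _
      _ ≤ _ := by
        rw [abs_mul, abs_mul]
        exact add_le_add (mul_le_of_le_one_right (abs_nonneg _) hw1)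
          (mul_le_of_le_one_left (abs_nonneg _) hu1)
  refine (Finset.sum_le_sum fun a _ => hterm a).trans ?_
  rw [Finset.sum_add_distrib,
    Equiv.sum_comp π fun b => |overlap j b - (if blockOf m b = j then (1 : ℝ) else 0)|]
  linarith [sum_abs_overlap_sub_le (n := n) i, sum_abs_overlap_sub_le (n := n) j]

/-! ### The size of a class of permutations with the same block counts -/

/-- The entropy of the discretization of `μ` to the `m`-grid. For a probability measure this is
`∑ -p log (m² p)` over the masses `p` of the `m²` squares of the grid. -/
noncomputable def gridEntropy (μ : Measure (I × I)) (m : ℕ) : ℝ :=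
  ∑ i : Fin m, ∑ j : Fin m, Real.negMulLog (μ.real (cell m i ×ˢ cell m j)) - 2 * Real.log m

/-- The permutations with the same block counts on the `m`-grid as `π₀`. -/
def blockClass (m : ℕ) [NeZero m] {n : ℕ} (π₀ : Equiv.Perm (Fin n)) :
    Finset (Equiv.Perm (Fin n)) :=
  Finset.univ.filter fun π =>
    blockCount (blockOf m) (blockOf m) π = blockCount (blockOf m) (blockOf m) π₀

lemma mem_blockClass_self (m : ℕ) [NeZero m] {n : ℕ} (π₀ : Equiv.Perm (Fin n)) :
    π₀ ∈ blockClass m π₀ := by simp [blockClass]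

lemma blockClass_card_pos (m : ℕ) [NeZero m] {n : ℕ} (π₀ : Equiv.Perm (Fin n)) :
    0 < (blockClass m π₀).card := Finset.card_pos.2 ⟨π₀, mem_blockClass_self m π₀⟩

lemma blockCount_le {m n : ℕ} [NeZero m] (π : Equiv.Perm (Fin n)) (i j : Fin m) :
    blockCount (blockOf m) (blockOf m) π i j ≤ n := by
  rw [blockCount_eq_blockSize]
  simpa using blockSize_le (fun a => (blockOf m a, blockOf m (π a))) (i, j)

lemma log_card_blockClass (m : ℕ) [NeZero m] {n : ℕ} (π₀ : Equiv.Perm (Fin n)) :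
    Real.log (blockClass m π₀).card =
      2 * ∑ i, Real.log ((blockSize (blockOf m (n := n)) i)! : ℝ) -
        ∑ i, ∑ j, Real.log ((blockCount (blockOf m) (blockOf m) π₀ i j)! : ℝ) := by
  have h := congrArg (fun k : ℕ => Real.log (k : ℝ))
    (card_blockCount_mul (blockOf m) (blockOf m) π₀)
  have hne : ∀ k : ℕ, ((k ! : ℕ) : ℝ) ≠ 0 := fun k => by exact_mod_cast k.factorial_ne_zero
  have hc : ((blockClass m π₀).card : ℝ) ≠ 0 := by exact_mod_cast (blockClass_card_pos m π₀).ne'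
  simp only [Nat.cast_mul, Nat.cast_prod] at h
  change Real.log (((blockClass m π₀).card : ℝ) * _) = _ at h
  rw [Real.log_mul hc (Finset.prod_ne_zero_iff.2 fun i _ => Finset.prod_ne_zero_iff.2
      fun j _ => hne _), Real.log_mul (Finset.prod_ne_zero_iff.2 fun i _ => hne _)
      (Finset.prod_ne_zero_iff.2 fun i _ => hne _),
    Real.log_prod (fun i _ => Finset.prod_ne_zero_iff.2 fun j _ => hne _),
    Real.log_prod (fun i _ => hne _)] at h
  simp_rw [Real.log_prod (fun i _ => hne _)] at h
  linarith

lemma abs_sum_fin_le {m : ℕ} {f : Fin m → ℝ} {c : ℝ} (h : ∀ i, |f i| ≤ c) :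
    |∑ i, f i| ≤ m * c :=
  (Finset.abs_sum_le_sum_abs _ _).trans
    ((Finset.sum_le_card_nsmul _ _ c fun i _ => h i).trans (by simp))

lemma abs_sum_sum_fin_le {m : ℕ} {f : Fin m → Fin m → ℝ} {c : ℝ} (h : ∀ i j, |f i j| ≤ c) :
    |∑ i, ∑ j, f i j| ≤ m ^ 2 * c :=
  (abs_sum_fin_le fun i => abs_sum_fin_le (h i)).trans (le_of_eq (by ring))

lemma abs_log_card_blockClass_sub_le (m : ℕ) [NeZero m] {n : ℕ} (hn : n ≠ 0)
    (π₀ : Equiv.Perm (Fin n)) :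
    |Real.log (blockClass m π₀).card - Real.log (n ! : ℝ) -
      n * (∑ i, ∑ j, Real.negMulLog (blockCount (blockOf m) (blockOf m) π₀ i j / n) -
        2 * ∑ i, Real.negMulLog (blockSize (blockOf m (n := n)) i / n))| ≤
      (m ^ 2 + 2 * m + 1) * (1 + Real.log n) := by
  set N := blockCount (blockOf m) (blockOf m) π₀
  set k := blockSize (blockOf m (n := n))
  let E : ℕ → ℝ := fun l => Real.log (l ! : ℝ) - (l * Real.log n - l - n * Real.negMulLog (l / n))
  have hE : ∀ l ≤ n, |E l| ≤ 1 + Real.log n := fun l hl => abs_log_factorial_add_negMulLog_le hn hl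
  have hlog : ∀ l : ℕ, Real.log (l ! : ℝ) =
      E l + (l * (Real.log n - 1) - n * Real.negMulLog (l / n)) := fun l => by simp only [E]; ring
  have hk : ∑ i, (k i : ℝ) = n := by
    have := sum_blockSize (blockOf m (n := n)); rw [Fintype.card_fin] at this; exact_mod_cast this
  have hN : ∑ i, ∑ j, (N i j : ℝ) = n := by
    have := sum_blockCount (blockOf m) (blockOf m) π₀
    rw [Fintype.card_fin] at this; exact_mod_cast this
  have hnn : (n : ℝ) / n = 1 := div_self (by exact_mod_cast hn)
  have key : Real.log (blockClass m π₀).card - Real.log (n ! : ℝ) -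
      n * (∑ i, ∑ j, Real.negMulLog (N i j / n) - 2 * ∑ i, Real.negMulLog (k i / n)) =
      2 * ∑ i, E (k i) - ∑ i, ∑ j, E (N i j) - E n := by
    rw [log_card_blockClass]
    simp_rw [hlog, Finset.sum_add_distrib, Finset.sum_sub_distrib, ← Finset.sum_mul,
      ← Finset.mul_sum]
    change 2 * (∑ i, E (k i) + ((∑ i, (k i : ℝ)) * _ - _)) - (∑ i, ∑ j, E (N i j) +
      ((∑ i, ∑ j, (N i j : ℝ)) * _ - _)) - _ - _ = _
    rw [hk, hN, hnn, Real.negMulLog_one]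
    ring
  rw [key]
  have h1 : |∑ i, E (k i)| ≤ m * (1 + Real.log n) :=
    abs_sum_fin_le fun i => hE _ (by simpa using blockSize_le (blockOf m (n := n)) i)
  have h2 : |∑ i, ∑ j, E (N i j)| ≤ m ^ 2 * (1 + Real.log n) :=
    abs_sum_sum_fin_le fun i j => hE _ (blockCount_le π₀ i j)
  have h3 := hE n le_rfl
  calc |2 * ∑ i, E (k i) - ∑ i, ∑ j, E (N i j) - E n|
      ≤ 2 * |∑ i, E (k i)| + |∑ i, ∑ j, E (N i j)| + |E n| := by
        refine (abs_sub _ _).trans (add_le_add_left ((abs_sub _ _).trans ?_) _)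
        rw [abs_mul, abs_two]
    _ ≤ _ := by linarith

/-- Uniform continuity of `z ↦ -z log z` on `[0, 1]`. -/
lemma exists_negMulLog_close {ε : ℝ} (hε : 0 < ε) :
    ∃ δ > 0, ∀ x ∈ Set.Icc (0 : ℝ) 1, ∀ y ∈ Set.Icc (0 : ℝ) 1, |x - y| < δ →
      |Real.negMulLog x - Real.negMulLog y| < ε := by
  have h := (isCompact_Icc (a := (0 : ℝ)) (b := 1)).uniformContinuousOn_of_continuous
    Real.continuous_negMulLog.continuousOn
  exact Metric.uniformContinuousOn_iff.1 h ε hε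

lemma eventually_const_div_lt (c : ℝ) {δ : ℝ} (hδ : 0 < δ) : ∀ᶠ n : ℕ in atTop, c / n < δ :=
  (tendsto_const_div_atTop_nhds_zero_nat c).eventually_lt_const hδ

lemma eventually_mul_log_div_lt (c : ℝ) {δ : ℝ} (hδ : 0 < δ) :
    ∀ᶠ n : ℕ in atTop, c * (1 + Real.log n) / n < δ := by
  have h1 : Tendsto (fun n : ℕ => Real.log (n : ℝ) / n) atTop (nhds 0) :=
    Real.isLittleO_log_id_atTop.tendsto_div_nhds_zero.comp tendsto_natCast_atTop_atTop
  have h2 := ((tendsto_const_div_atTop_nhds_zero_nat (1 : ℝ)).add h1).const_mul c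
  simp only [add_zero, mul_zero] at h2
  filter_upwards [h2.eventually_lt_const hδ] with n hn
  rwa [mul_div_assoc, add_div]

lemma abs_gridEntropy_sub_le {μ ν : Measure (I × I)} [IsProbabilityMeasure μ]
    [IsProbabilityMeasure ν] {m : ℕ} {ε δ : ℝ}
    (hδ : ∀ x ∈ Set.Icc (0 : ℝ) 1, ∀ y ∈ Set.Icc (0 : ℝ) 1, |x - y| < δ →
      |Real.negMulLog x - Real.negMulLog y| < ε)
    (h : ∀ i j, |μ.real (cell m i ×ˢ cell m j) - ν.real (cell m i ×ˢ cell m j)| < δ) :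
    |gridEntropy μ m - gridEntropy ν m| ≤ m ^ 2 * ε := by
  rw [gridEntropy, gridEntropy, sub_sub_sub_cancel_right, ← Finset.sum_sub_distrib]
  simp_rw [← Finset.sum_sub_distrib]
  exact abs_sum_sum_fin_le fun i j => (hδ _ ⟨measureReal_nonneg, measureReal_le_one⟩ _
    ⟨measureReal_nonneg, measureReal_le_one⟩ (h i j)).le

/-- On the exponential scale, the proportion of permutations of `n` points with the block counts of
`π` is the grid entropy of `γ_π`, uniformly in `π`. -/
theorem eventually_log_card_blockClass (m : ℕ) [NeZero m] {ε : ℝ} (hε : 0 < ε) :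
    ∀ᶠ n : ℕ in atTop, ∀ π : Equiv.Perm (Fin n),
      |(Real.log (blockClass m π).card - Real.log (n ! : ℝ)) / n -
        gridEntropy (permMeasure π) m| ≤ ε := by
  have hm : (0 : ℝ) < m := by exact_mod_cast NeZero.pos m
  set η : ℝ := ε / (2 * (m ^ 2 + 2 * m)) with hη
  obtain ⟨δ, hδ, hδε⟩ := exists_negMulLog_close (ε := η) (by positivity)
  filter_upwards [eventually_ne_atTop 0, eventually_const_div_lt 4 hδ,
    eventually_mul_log_div_lt (m ^ 2 + 2 * m + 1) (half_pos hε)] with n hn hn4 hnlog π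
  have hn0 : (0 : ℝ) < n := by exact_mod_cast Nat.pos_of_ne_zero hn
  have : IsProbabilityMeasure (permMeasure π) := (ofPerm hn π).1.2
  have hunit : ∀ k : ℕ, k ≤ n → (k : ℝ) / n ∈ Set.Icc (0 : ℝ) 1 := fun k hk =>
    ⟨by positivity, (div_le_one hn0).2 (by exact_mod_cast hk)⟩
  have hN : |∑ i, ∑ j, Real.negMulLog (blockCount (blockOf m) (blockOf m) π i j / n) -
      ∑ i, ∑ j, Real.negMulLog ((permMeasure π).real (cell m i ×ˢ cell m j))| ≤ m ^ 2 * η := by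
    rw [← Finset.sum_sub_distrib]
    simp_rw [← Finset.sum_sub_distrib]
    refine abs_sum_sum_fin_le fun i j => (hδε _ (hunit _ (blockCount_le π i j)) _
      ⟨measureReal_nonneg, measureReal_le_one⟩ ?_).le
    rw [abs_sub_comm]
    exact (abs_permMeasure_real_cell_sub_le π i j).trans_lt hn4
  have hk : |∑ i, Real.negMulLog (blockSize (blockOf m (n := n)) i / n) - Real.log m| ≤ m * η := by
    have hlog : Real.log m = ∑ _i : Fin m, Real.negMulLog (1 / m) := by
      simp [Real.negMulLog, hm.ne']
    rw [hlog, ← Finset.sum_sub_distrib]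
    refine abs_sum_fin_le fun i => (hδε _ (hunit _ ?_) _ ⟨by positivity, ?_⟩ ?_).le
    · simpa using blockSize_le (blockOf m (n := n)) i
    · rw [div_le_one hm]; exact_mod_cast NeZero.pos m
    · have h := abs_blockSize_sub_le hn i
      rw [show (blockSize (blockOf m (n := n)) i : ℝ) / n - 1 / m =
        (blockSize (blockOf m (n := n)) i - n / m) / n by field_simp, abs_div, Nat.abs_cast]
      refine lt_of_le_of_lt ?_ hn4
      gcongr
      linarith
  have hmain := abs_log_card_blockClass_sub_le m hn π
  have hdiv : |(Real.log (blockClass m π).card - Real.log (n ! : ℝ)) / n -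
      (∑ i, ∑ j, Real.negMulLog (blockCount (blockOf m) (blockOf m) π i j / n) -
        2 * ∑ i, Real.negMulLog (blockSize (blockOf m (n := n)) i / n))| ≤ ε / 2 := by
    refine le_trans ?_ hnlog.le
    rw [le_div_iff₀ hn0]
    refine le_trans (le_of_eq ?_) hmain
    rw [← abs_of_pos hn0, ← abs_mul, abs_of_pos hn0]
    congr 1
    field_simp
  have hηm : (m ^ 2 + 2 * m) * η = ε / 2 := by rw [hη]; field_simp
  rw [gridEntropy]
  rw [abs_le] at *
  constructor <;> nlinarith [hN.1, hN.2, hk.1, hk.2, hdiv.1, hdiv.2]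

/-! ### Permutations with prescribed approximate block counts -/

/-- Any matrix of natural numbers whose row and column sums fit into the blocks is dominated by the
block counts of a permutation: place a partial matching and complete it arbitrarily. -/
theorem exists_perm_le_blockCount {α ι κ : Type*} [Fintype α] [Fintype ι]
    [DecidableEq ι] [Fintype κ] [DecidableEq κ] (r : α → ι) (s : α → κ) (N : ι → κ → ℕ)
    (hr : ∀ i, ∑ j, N i j ≤ blockSize r i) (hs : ∀ j, ∑ i, N i j ≤ blockSize s j) :
    ∃ π : Equiv.Perm α, ∀ i j, N i j ≤ blockCount r s π i j := by
  classical
  have e1 : ∀ i, Nonempty ((Σ j, Fin (N i j)) ↪ {a // r a = i}) := fun i =>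
    Function.Embedding.nonempty_of_card_le (by simpa [Fintype.card_subtype, blockSize] using hr i)
  have e2 : ∀ j, Nonempty ((Σ i, Fin (N i j)) ↪ {a // s a = j}) := fun j =>
    Function.Embedding.nonempty_of_card_le (by simpa [Fintype.card_subtype, blockSize] using hs j)
  let f1 : (Σ i, Σ j, Fin (N i j)) → α := fun x => ((e1 x.1).some x.2).1
  let f2 : (Σ i, Σ j, Fin (N i j)) → α := fun x => ((e2 x.2.1).some ⟨x.1, x.2.2⟩).1
  have hf1r : ∀ x, r (f1 x) = x.1 := fun x => ((e1 x.1).some x.2).2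
  have hf2s : ∀ x, s (f2 x) = x.2.1 := fun x => ((e2 x.2.1).some ⟨x.1, x.2.2⟩).2
  have hf1 : Function.Injective f1 := by
    rintro ⟨i, x⟩ ⟨i', x'⟩ h
    obtain rfl : i = i' := by simpa only [hf1r] using congrArg r h
    exact congrArg (Sigma.mk i) ((e1 i).some.injective (Subtype.ext h))
  have hf2 : Function.Injective f2 := by
    rintro ⟨i, j, k⟩ ⟨i', j', k'⟩ h
    obtain rfl : j = j' := by simpa only [hf2s] using congrArg s h
    have := (e2 j).some.injective (Subtype.ext h)
    simp only [Sigma.mk.injEq] at this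
    obtain ⟨rfl, this⟩ := this
    rw [heq_iff_eq] at this
    rw [this]
  let e : {a // a ∈ Set.range f1} ≃ {a // a ∈ Set.range f2} :=
    (Equiv.ofInjective f1 hf1).symm.trans (Equiv.ofInjective f2 hf2)
  have he : ∀ x, e.extendSubtype (f1 x) = f2 x := fun x => by
    rw [Equiv.extendSubtype_apply_of_mem e _ ⟨x, rfl⟩]
    have : (⟨f1 x, ⟨x, rfl⟩⟩ : {a // a ∈ Set.range f1}) = Equiv.ofInjective f1 hf1 x := rfl
    simp only [e, Equiv.trans_apply]
    rw [this, Equiv.symm_apply_apply]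
    rfl
  refine ⟨e.extendSubtype, fun i j => ?_⟩
  have hcard : (Finset.univ.image fun k : Fin (N i j) => f1 ⟨i, j, k⟩).card = N i j := by
    rw [Finset.card_image_of_injective, Finset.card_univ, Fintype.card_fin]
    intro k k' h
    simpa using hf1 h
  rw [← hcard]
  refine Finset.card_le_card fun a ha => ?_
  obtain ⟨k, -, rfl⟩ := Finset.mem_image.1 ha
  simp [he, hf1r, hf2s]

/-- Rounding a doubly stochastic matrix (up to the factor `1/m`) to block counts, with an error that
does not depend on `n`. -/
theorem exists_perm_blockCount_near {m : ℕ} [NeZero m] {p : Fin m → Fin m → ℝ}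
    (hp : ∀ i j, 0 ≤ p i j) (hrow : ∀ i, ∑ j, p i j = 1 / m) (hcol : ∀ j, ∑ i, p i j = 1 / m)
    {n : ℕ} (hn : n ≠ 0) :
    ∃ π : Equiv.Perm (Fin n), ∀ i j,
      |(blockCount (blockOf m) (blockOf m) π i j : ℝ) - n * p i j| ≤ m ^ 2 * (2 * m + 1) := by
  have hm : (0 : ℝ) < m := by exact_mod_cast NeZero.pos m
  have hm1 : (1 : ℝ) ≤ m := by exact_mod_cast NeZero.pos m
  have hp1 : ∀ i j, p i j ≤ 1 := fun i j =>
    (Finset.single_le_sum (fun j _ => hp i j) (Finset.mem_univ j)).trans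
      ((hrow i).le.trans ((div_le_one hm).2 hm1))
  -- Blocks have at least `n/m - 2` elements, so that `(n - 2m) p` fits into them.
  have hfit : ∀ q : Fin m → ℝ, (∀ j, 0 ≤ q j) → ∑ j, q j = 1 / m → ∀ i : Fin m,
      ∑ j, ⌊((n : ℝ) - 2 * m) * q j⌋₊ ≤ blockSize (blockOf m (n := n)) i := by
    intro q hq hsum i
    rcases le_total (n : ℝ) (2 * m) with h | h
    · rw [Finset.sum_eq_zero]
      · exact Nat.zero_le _
      · exact fun j _ => Nat.floor_eq_zero.2
          ((mul_nonpos_of_nonpos_of_nonneg (by linarith) (hq j)).trans_lt one_pos)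
    · have h1 : ∑ j, (⌊((n : ℝ) - 2 * m) * q j⌋₊ : ℝ) ≤ ∑ j, ((n : ℝ) - 2 * m) * q j :=
        Finset.sum_le_sum fun j _ => Nat.floor_le (mul_nonneg (by linarith) (hq j))
      have h2 := abs_le.1 (abs_blockSize_sub_le hn i)
      have h3 : ((n : ℝ) - 2 * m) * (1 / m) = n / m - 2 := by field_simp
      rw [← Finset.mul_sum, hsum, h3] at h1
      have h4 : ∑ j, (⌊((n : ℝ) - 2 * m) * q j⌋₊ : ℝ) ≤ blockSize (blockOf m (n := n)) i := by
        linarith [h2.1]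
      exact_mod_cast h4
  obtain ⟨π, hπ⟩ := exists_perm_le_blockCount (blockOf m (n := n)) (blockOf m (n := n))
    (fun i j => ⌊((n : ℝ) - 2 * m) * p i j⌋₊) (fun i => hfit _ (hp i) (hrow i) i)
    (fun j => hfit (fun i => p i j) (fun i => hp i j) (hcol j) j)
  refine ⟨π, fun i j => ?_⟩
  set D : Fin m → Fin m → ℝ := fun i j =>
    blockCount (blockOf m) (blockOf m) π i j - n * p i j with hD
  have hlow : ∀ i j, 0 ≤ D i j + (2 * m + 1) := fun i j => by
    have h1 := Nat.lt_floor_add_one (((n : ℝ) - 2 * m) * p i j)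
    have h2 : (⌊((n : ℝ) - 2 * m) * p i j⌋₊ : ℝ) ≤ blockCount (blockOf m) (blockOf m) π i j := by
      exact_mod_cast hπ i j
    have h3 := hp1 i j
    simp only [hD]
    nlinarith
  have hsum : ∑ i, ∑ j, (D i j + (2 * m + 1)) = m ^ 2 * (2 * m + 1) := by
    have h1 : ∑ i, ∑ j, (blockCount (blockOf m) (blockOf m) π i j : ℝ) = n := by
      have := sum_blockCount (blockOf m) (blockOf m) π
      rw [Fintype.card_fin] at this; exact_mod_cast this
    simp only [hD, Finset.sum_add_distrib, Finset.sum_sub_distrib, h1, ← Finset.mul_sum, hrow]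
    simp
    field_simp
  have hupp : D i j + (2 * m + 1) ≤ m ^ 2 * (2 * m + 1) := by
    rw [← hsum]
    exact (Finset.single_le_sum (fun j _ => hlow i j) (Finset.mem_univ j)).trans
      (Finset.single_le_sum (f := fun i => ∑ j, (D i j + (2 * m + 1)))
        (fun i _ => Finset.sum_nonneg fun j _ => hlow i j) (Finset.mem_univ i))
  have := hlow i j
  rw [abs_le]
  constructor <;> nlinarith

/-! ### The grid and measures with uniform marginals -/

lemma ae_mem_cell (m : ℕ) [NeZero m] : ∀ᵐ x : I, ∃ i, x ∈ cell m i := by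
  have hm : MeasurableSet (⋃ i, cell m i) := MeasurableSet.iUnion (measurableSet_cell m)
  have h1 : volume (⋃ i, cell m i) = 1 := by
    rw [measure_iUnion (pairwise_disjoint_cell m) (measurableSet_cell m)]
    simp only [volume_cell, tsum_fintype, Finset.sum_const, Finset.card_univ, Fintype.card_fin,
      nsmul_eq_mul]
    exact ENNReal.mul_inv_cancel (by exact_mod_cast NeZero.ne m) (ENNReal.natCast_ne_top m)
  filter_upwards [mem_ae_iff.2 ((prob_compl_eq_zero_iff hm).2 h1)] with x hx
  simpa using hx

/-- A measure on the unit square both of whose marginals are Lebesgue measure. -/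
structure UniformMarginals (μ : Measure (I × I)) : Prop where
  fst_eq : μ.fst = volume
  snd_eq : μ.snd = volume

lemma uniformMarginals (γ : Permuton) : UniformMarginals (γ.1 : Measure (I × I)) :=
  ⟨γ.2.1, γ.2.2⟩

lemma uniformMarginals_volume : UniformMarginals (volume : Measure (I × I)) :=
  ⟨by rw [Measure.volume_eq_prod, Measure.fst_prod],
    by rw [Measure.volume_eq_prod, Measure.snd_prod]⟩

lemma measurableSet_square (m : ℕ) (i j : Fin m) : MeasurableSet (cell m i ×ˢ cell m j) :=
  (measurableSet_cell m i).prod (measurableSet_cell m j)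

lemma pairwise_disjoint_square (m : ℕ) : Pairwise (Function.onFun Disjoint
    fun x : Fin m × Fin m => cell m x.1 ×ˢ cell m x.2) := by
  rintro ⟨i, j⟩ ⟨i', j'⟩ h
  rw [Function.onFun, Set.disjoint_prod]
  by_cases hi : i = i'
  · exact Or.inr (pairwise_disjoint_cell m fun hj => h (by simp_all))
  · exact Or.inl (pairwise_disjoint_cell m hi)

namespace UniformMarginals

variable {μ : Measure (I × I)}

lemma isProbabilityMeasure (h : UniformMarginals μ) : IsProbabilityMeasure μ :=
  ⟨by rw [← Measure.fst_univ, h.fst_eq]; exact measure_univ⟩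

lemma measure_fst_preimage (h : UniformMarginals μ) {s : Set I} (hs : MeasurableSet s) :
    μ (Prod.fst ⁻¹' s) = volume s := by rw [← h.fst_eq, Measure.fst_apply hs]

lemma measure_snd_preimage (h : UniformMarginals μ) {s : Set I} (hs : MeasurableSet s) :
    μ (Prod.snd ⁻¹' s) = volume s := by rw [← h.snd_eq, Measure.snd_apply hs]

lemma ae_fst (h : UniformMarginals μ) {P : I → Prop} (hP : ∀ᵐ x, P x) : ∀ᵐ q ∂μ, P q.1 := by
  rw [← h.fst_eq] at hP
  exact ae_of_ae_map measurable_fst.aemeasurable hP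

lemma ae_snd (h : UniformMarginals μ) {P : I → Prop} (hP : ∀ᵐ x, P x) : ∀ᵐ q ∂μ, P q.2 := by
  rw [← h.snd_eq] at hP
  exact ae_of_ae_map measurable_snd.aemeasurable hP

lemma eq_sum_restrict (h : UniformMarginals μ) (m : ℕ) [NeZero m] :
    Measure.sum (fun x : Fin m × Fin m => μ.restrict (cell m x.1 ×ˢ cell m x.2)) = μ := by
  rw [← Measure.restrict_iUnion (pairwise_disjoint_square m)
    fun x => measurableSet_square m x.1 x.2]
  refine Measure.restrict_eq_self_of_ae_mem ?_
  filter_upwards [h.ae_fst (ae_mem_cell m), h.ae_snd (ae_mem_cell m)] with q ⟨i, hi⟩ ⟨j, hj⟩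
  exact Set.mem_iUnion.2 ⟨(i, j), hi, hj⟩

lemma integral_eq_sum (h : UniformMarginals μ) (m : ℕ) [NeZero m] {f : I × I → ℝ}
    (hf : Integrable f μ) :
    ∫ q, f q ∂μ = ∑ i : Fin m, ∑ j : Fin m, ∫ q in cell m i ×ˢ cell m j, f q ∂μ := by
  conv_lhs => rw [← h.eq_sum_restrict m, Measure.sum_fintype]
  rw [integral_finsetSum_measure fun x _ => hf.restrict, Fintype.sum_prod_type]

lemma sum_row (h : UniformMarginals μ) (m : ℕ) [NeZero m] (i : Fin m) :
    ∑ j, μ.real (cell m i ×ˢ cell m j) = 1 / m := by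
  have := h.isProbabilityMeasure
  rw [← measureReal_iUnion_fintype]
  · rw [one_div, ← volume_real_cell m i, measureReal_def, measureReal_def,
      ← h.measure_fst_preimage (measurableSet_cell m i)]
    congr 1
    refine measure_congr ?_
    filter_upwards [h.ae_snd (ae_mem_cell m)] with q ⟨j, hj⟩
    refine propext ⟨fun hq => ?_, fun hq => Set.mem_iUnion.2 ⟨j, hq, hj⟩⟩
    obtain ⟨j', hj'⟩ := Set.mem_iUnion.1 hq
    exact hj'.1
  · intro j j' hj
    exact pairwise_disjoint_square m (i := (i, j)) (j := (i, j')) (by simpa using hj)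
  · exact fun j => measurableSet_square m i j

lemma sum_col (h : UniformMarginals μ) (m : ℕ) [NeZero m] (j : Fin m) :
    ∑ i, μ.real (cell m i ×ˢ cell m j) = 1 / m := by
  have := h.isProbabilityMeasure
  rw [← measureReal_iUnion_fintype]
  · rw [one_div, ← volume_real_cell m j, measureReal_def, measureReal_def,
      ← h.measure_snd_preimage (measurableSet_cell m j)]
    congr 1
    refine measure_congr ?_
    filter_upwards [h.ae_fst (ae_mem_cell m)] with q ⟨i, hi⟩
    refine propext ⟨fun hq => ?_, fun hq => Set.mem_iUnion.2 ⟨i, hi, hq⟩⟩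
    obtain ⟨i', hi'⟩ := Set.mem_iUnion.1 hq
    exact hi'.2
  · intro i i' hi
    exact pairwise_disjoint_square m (i := (i, j)) (j := (i', j)) (by simpa using hi)
  · exact fun i => measurableSet_square m i j

lemma sum_sum (h : UniformMarginals μ) (m : ℕ) [NeZero m] :
    ∑ i : Fin m, ∑ j : Fin m, μ.real (cell m i ×ˢ cell m j) = 1 := by
  have hm : (m : ℝ) ≠ 0 := by exact_mod_cast NeZero.ne m
  simp [h.sum_row m, hm]

end UniformMarginals

lemma volume_real_square (m : ℕ) (i j : Fin m) :
    (volume : Measure (I × I)).real (cell m i ×ˢ cell m j) = ((m : ℝ) ^ 2)⁻¹ := by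
  rw [measureReal_def, Measure.volume_eq_prod, Measure.prod_prod, ENNReal.toReal_mul,
    ← measureReal_def, ← measureReal_def, volume_real_cell, volume_real_cell, sq, mul_inv]

/-! ### The variational formula for relative entropy -/

section Variational

variable {Ω : Type*} [MeasurableSpace Ω] {μ ν : Measure Ω}

/-- The functional `u ↦ ∫ u dμ + 1 - ∫ e^u dν`, whose supremum over bounded functions `u` is the
relative entropy of `μ` with respect to `ν`. -/
noncomputable def dualFunctional (μ ν : Measure Ω) (u : Ω → ℝ) : ℝ :=
  ∫ x, u x ∂μ + 1 - ∫ x, Real.exp (u x) ∂ν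

/-- The pointwise Young inequality behind the variational formula, in homogeneous form. -/
lemma mul_sub_exp_mul_le {p q : ℝ} (a : ℝ) (hp : 0 ≤ p) (hq : 0 < q) :
    a * p - Real.exp a * q ≤ -(q * Real.negMulLog (p / q)) - p := by
  rcases hp.eq_or_lt with rfl | hp
  · simp only [mul_zero, zero_div, Real.negMulLog_zero]
    nlinarith [Real.exp_pos a]
  · have h := Real.add_one_le_exp (a - Real.log (p / q))
    rw [Real.exp_sub, Real.exp_log (by positivity), le_div_iff₀ (by positivity)] at h
    rw [Real.negMulLog]
    have h2 := mul_le_mul_of_nonneg_right h hq.le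
    have h3 : p / q * q = p := div_mul_cancel₀ _ hq.ne'
    have h4 : (a - Real.log (p / q) + 1) * (p / q) * q = (a - Real.log (p / q) + 1) * p := by
      rw [mul_assoc, h3]
    have h5 : q * (-(p / q) * Real.log (p / q)) = -(p * Real.log (p / q)) := by
      field_simp
    rw [h4] at h2
    rw [h5]
    linarith

lemma abs_exp_sub_exp_le {x y T : ℝ} (hx : x ≤ T) (hy : y ≤ T) :
    |Real.exp x - Real.exp y| ≤ Real.exp T * |x - y| := by
  wlog h : y ≤ x generalizing x y
  · rw [abs_sub_comm, abs_sub_comm x]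
    exact this hy hx (le_of_not_ge h)
  rw [abs_of_nonneg (sub_nonneg.2 (Real.exp_le_exp.2 h)), abs_of_nonneg (sub_nonneg.2 h)]
  have h1 := Real.add_one_le_exp (y - x)
  have h2 : Real.exp y = Real.exp x * Real.exp (y - x) := by rw [← Real.exp_add]; ring_nf
  have h3 : Real.exp x ≤ Real.exp T := Real.exp_le_exp.2 hx
  nlinarith [Real.exp_pos x]

/-- `z ↦ z` truncated to `[1/(k+1), k+1]`. -/
noncomputable def truncation (k : ℕ) (z : ℝ) : ℝ := max (1 / (k + 1)) (min (k + 1) z)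

lemma one_div_le_truncation (k : ℕ) (z : ℝ) : 1 / ((k : ℝ) + 1) ≤ truncation k z := le_max_left _ _

lemma truncation_pos (k : ℕ) (z : ℝ) : 0 < truncation k z :=
  lt_of_lt_of_le (by positivity) (one_div_le_truncation k z)

lemma truncation_le (k : ℕ) (z : ℝ) : truncation k z ≤ k + 1 := by
  have hk : (0 : ℝ) ≤ k := Nat.cast_nonneg k
  refine max_le ?_ (min_le_left _ _)
  rw [div_le_iff₀ (by positivity)]
  nlinarith

lemma measurable_truncation (k : ℕ) : Measurable (truncation k) := by
  unfold truncation; fun_prop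

lemma abs_log_truncation_le (k : ℕ) (z : ℝ) :
    |Real.log (truncation k z)| ≤ Real.log (k + 1) := by
  rw [abs_le]
  constructor
  · have := Real.log_le_log (by positivity) (one_div_le_truncation k z)
    rwa [one_div, Real.log_inv] at this
  · exact Real.log_le_log (truncation_pos k z) (truncation_le k z)

lemma tendsto_truncation {z : ℝ} (hz : 0 ≤ z) :
    Tendsto (fun k => truncation k z) atTop (nhds z) := by
  have h1 : Tendsto (fun k : ℕ => max (1 / ((k : ℝ) + 1)) z) atTop (nhds (max 0 z)) :=
    tendsto_one_div_add_atTop_nhds_zero_nat.max tendsto_const_nhds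
  rw [max_eq_right hz] at h1
  refine h1.congr' ?_
  obtain ⟨N, hN⟩ := exists_nat_ge z
  filter_upwards [eventually_ge_atTop N] with k hk
  have : (N : ℝ) ≤ k := by exact_mod_cast hk
  rw [truncation, min_eq_right (by linarith)]

lemma tendsto_mul_log_truncation {z : ℝ} (hz : 0 ≤ z) :
    Tendsto (fun k => z * Real.log (truncation k z) + 1 - truncation k z) atTop
      (nhds (InformationTheory.klFun z)) := by
  rw [InformationTheory.klFun_apply]
  refine Tendsto.sub (Tendsto.add_const _ ?_) (tendsto_truncation hz)
  rcases hz.eq_or_lt with rfl | hz'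
  · simp
  · exact ((tendsto_truncation hz).log hz'.ne').const_mul z

lemma mul_log_truncation_nonneg (k : ℕ) (z : ℝ) :
    0 ≤ z * Real.log (truncation k z) + 1 - truncation k z := by
  have hk : (0 : ℝ) ≤ k := Nat.cast_nonneg k
  have h1 := InformationTheory.klFun_nonneg (truncation_pos k z).le
  rw [InformationTheory.klFun_apply] at h1
  suffices 0 ≤ (z - truncation k z) * Real.log (truncation k z) by linarith
  have hk1 : 1 / ((k : ℝ) + 1) ≤ 1 := by rw [div_le_one (by positivity)]; linarith
  rcases le_total z (1 / (k + 1)) with h | h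
  · have : truncation k z = 1 / (k + 1) := by
      rw [truncation, min_eq_right (by linarith), max_eq_left h]
    rw [this]
    exact mul_nonneg_of_nonpos_of_nonpos (by linarith) (Real.log_nonpos (by positivity) hk1)
  rcases le_total z (k + 1) with h' | h'
  · have : truncation k z = z := by rw [truncation, min_eq_right h', max_eq_right h]
    simp [this]
  · have : truncation k z = k + 1 := by
      rw [truncation, min_eq_left h', max_eq_right (by linarith)]
    rw [this]
    exact mul_nonneg (by linarith) (Real.log_nonneg (by linarith))

/-- If the dual functional is bounded on bounded functions then `μ` is absolutely continuous: on a
`ν`-null set of positive `μ`-measure `u` may be taken arbitrarily large for free. -/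
lemma absolutelyContinuous_of_dualFunctional_le [IsProbabilityMeasure μ] [IsProbabilityMeasure ν]
    {C : ℝ} (h : ∀ u : Ω → ℝ, Measurable u → (∃ T, ∀ x, |u x| ≤ T) → dualFunctional μ ν u ≤ C) :
    μ ≪ ν := by
  refine Measure.AbsolutelyContinuous.mk fun s hs hνs => ?_
  by_contra hμs
  have hpos : 0 < μ.real s := ENNReal.toReal_pos hμs (measure_ne_top _ _)
  set t : ℝ := (|C| + 1) / μ.real s
  have ht : 0 ≤ t := by positivity
  have h1 := h (s.indicator fun _ => t) (measurable_const.indicator hs) ⟨t, fun x => by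
    by_cases hx : x ∈ s <;> simp [hx, ht, abs_of_nonneg]⟩
  have h2 : ∫ x, Real.exp (s.indicator (fun _ => t) x) ∂ν = 1 := by
    rw [integral_congr_ae (g := fun _ => (1 : ℝ))]
    · simp
    · filter_upwards [measure_eq_zero_iff_ae_notMem.1 hνs] with x hx
      simp [hx]
  rw [dualFunctional, h2, integral_indicator_const _ hs, smul_eq_mul, mul_comm,
    div_mul_cancel₀ _ hpos.ne'] at h1
  linarith [le_abs_self C]

/-- The relative entropy is at most any bound of the dual functional on bounded functions, by
Fatou's lemma for the truncations of the logarithm of the density. -/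
lemma lintegral_klFun_le_of_dualFunctional_le [IsProbabilityMeasure μ] [IsProbabilityMeasure ν]
    (hμν : μ ≪ ν) {C : ℝ}
    (h : ∀ u : Ω → ℝ, Measurable u → (∃ T, ∀ x, |u x| ≤ T) → dualFunctional μ ν u ≤ C) :
    ∫⁻ x, ENNReal.ofReal (InformationTheory.klFun (μ.rnDeriv ν x).toReal) ∂ν ≤
      ENNReal.ofReal C := by
  set g : Ω → ℝ := fun x => (μ.rnDeriv ν x).toReal with hg
  have hgm : Measurable g := (Measure.measurable_rnDeriv μ ν).ennreal_toReal
  have hgi : Integrable g ν := Measure.integrable_toReal_rnDeriv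
  let F : ℕ → Ω → ℝ := fun k x => g x * Real.log (truncation k (g x)) + 1 - truncation k (g x)
  have htm : ∀ k, Measurable fun x => truncation k (g x) := fun k =>
    (measurable_truncation k).comp hgm
  have hFm : ∀ k, Measurable (F k) := fun k =>
    ((hgm.mul (htm k).log).add measurable_const).sub (htm k)
  have hti : ∀ k, Integrable (fun x => truncation k (g x)) ν := fun k =>
    Integrable.of_bound (htm k).aestronglyMeasurable (k + 1) (ae_of_all _ fun x => by
      rw [Real.norm_eq_abs, abs_of_pos (truncation_pos k _)]; exact truncation_le k _)
  have hli : ∀ k, Integrable (fun x => g x * Real.log (truncation k (g x))) ν := fun k =>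
    hgi.mul_bdd (c := Real.log (k + 1)) (htm k).log.aestronglyMeasurable (ae_of_all _ fun x =>
      abs_log_truncation_le k _)
  have hFi : ∀ k, Integrable (F k) ν := fun k =>
    ((hli k).add (integrable_const 1)).sub (hti k)
  have hF : ∀ k, ∫⁻ x, ENNReal.ofReal (F k x) ∂ν ≤ ENNReal.ofReal C := by
    intro k
    rw [← ofReal_integral_eq_lintegral_ofReal (hFi k)
      (ae_of_all _ fun x => mul_log_truncation_nonneg k _)]
    refine ENNReal.ofReal_le_ofReal ?_
    refine le_trans (le_of_eq ?_) (h (fun x => Real.log (truncation k (g x))) (htm k).log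
      ⟨Real.log (k + 1), fun x => abs_log_truncation_le k _⟩)
    rw [dualFunctional, ← integral_rnDeriv_smul hμν]
    simp only [F, Real.exp_log (truncation_pos _ _), smul_eq_mul]
    have hl1 : Integrable (fun x => g x * Real.log (truncation k (g x)) + 1) ν :=
      (hli k).add (integrable_const 1)
    rw [integral_sub hl1 (hti k),
      integral_add (hli k) (integrable_const 1)]
    simp [hg]
  calc ∫⁻ x, ENNReal.ofReal (InformationTheory.klFun (g x)) ∂ν
      = ∫⁻ x, liminf (fun k => ENNReal.ofReal (F k x)) atTop ∂ν := by
        refine lintegral_congr fun x => ?_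
        exact ((ENNReal.continuous_ofReal.tendsto _).comp
          (tendsto_mul_log_truncation ENNReal.toReal_nonneg)).liminf_eq.symm
    _ ≤ liminf (fun k => ∫⁻ x, ENNReal.ofReal (F k x) ∂ν) atTop :=
        lintegral_liminf_le fun k => (hFm k).ennreal_ofReal
    _ ≤ ENNReal.ofReal C := (liminf_le_liminf (Eventually.of_forall hF)).trans (by simp)

/-- On functions bounded by `T`, the dual functional is Lipschitz in `L¹(μ + ν)`, so that it is
enough to test it on bounded continuous functions. -/
lemma exists_boundedContinuous_dualFunctional_ge [TopologicalSpace Ω] [NormalSpace Ω]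
    [BorelSpace Ω] [IsProbabilityMeasure μ] [IsProbabilityMeasure ν] [(μ + ν).WeaklyRegular]
    {u : Ω → ℝ} (hu : Measurable u) {T : ℝ} (hT : ∀ x, |u x| ≤ T) {ε : ℝ} (hε : 0 < ε) :
    ∃ ψ : Ω → ℝ, Continuous ψ ∧
      dualFunctional μ ν u - ε ≤ dualFunctional μ ν ψ := by
  have huint : ∀ (ρ : Measure Ω) [IsFiniteMeasure ρ], Integrable u ρ := fun ρ _ =>
    Integrable.of_bound hu.aestronglyMeasurable T (ae_of_all _ hT)
  set η : ℝ := ε / (1 + Real.exp T)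
  obtain ⟨ψ₀, hψ₀, hψ₀i⟩ := (huint (μ + ν)).exists_boundedContinuous_integral_sub_le
    (ε := η) (by positivity)
  set ψ : Ω → ℝ := fun x => max (-T) (min T (ψ₀ x))
  have hψc : Continuous ψ := by have := ψ₀.continuous; fun_prop
  have hψT : ∀ x, |ψ x| ≤ T := fun x => by
    have hT0 : 0 ≤ T := (abs_nonneg _).trans (hT x)
    exact abs_le.2 ⟨le_max_left _ _, max_le (by linarith) (min_le_left _ _)⟩
  have hψint : ∀ (ρ : Measure Ω) [IsFiniteMeasure ρ], Integrable ψ ρ := fun ρ _ =>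
    Integrable.of_bound hψc.measurable.aestronglyMeasurable T (ae_of_all _ hψT)
  have hle : ∀ x, |u x - ψ x| ≤ ‖u x - ψ₀ x‖ := fun x => by
    have h1 := abs_le.1 (hT x)
    have h2 : u x = max (-T) (min T (u x)) := by rw [min_eq_right h1.2, max_eq_right h1.1]
    calc |u x - ψ x| = |max (-T) (min T (u x)) - max (-T) (min T (ψ₀ x))| := by rw [← h2]
      _ ≤ |min T (u x) - min T (ψ₀ x)| := by
        simpa using abs_max_sub_max_le_max (-T) (min T (u x)) (-T) (min T (ψ₀ x))
      _ ≤ |u x - ψ₀ x| := by simpa using abs_min_sub_min_le_max T (u x) T (ψ₀ x)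
  have hsum : ∫ x, |u x - ψ x| ∂μ + ∫ x, |u x - ψ x| ∂ν ≤ η := by
    have habs : ∀ (ρ : Measure Ω) [IsFiniteMeasure ρ], Integrable (fun x => |u x - ψ x|) ρ :=
      fun ρ _ => ((huint ρ).sub (hψint ρ)).abs
    rw [← integral_add_measure (habs μ) (habs ν)]
    exact (integral_mono (habs _) ((huint _).sub hψ₀i).norm hle).trans hψ₀
  have hμ0 : 0 ≤ ∫ x, |u x - ψ x| ∂μ := integral_nonneg fun _ => abs_nonneg _
  have hν0 : 0 ≤ ∫ x, |u x - ψ x| ∂ν := integral_nonneg fun _ => abs_nonneg _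
  have h1 : ∫ x, u x ∂μ - ∫ x, ψ x ∂μ ≤ η := by
    rw [← integral_sub (huint μ) (hψint μ)]
    have := (le_abs_self _).trans (abs_integral_le_integral_abs (μ := μ) (f := fun x => u x - ψ x))
    linarith
  have hexpi : ∀ χ : Ω → ℝ, Measurable χ → (∀ x, |χ x| ≤ T) →
      Integrable (fun x => Real.exp (χ x)) ν := fun χ hχ hχT =>
    Integrable.of_bound hχ.exp.aestronglyMeasurable (Real.exp T) (ae_of_all _ fun x => by
      rw [Real.norm_eq_abs, abs_of_pos (Real.exp_pos _)]
      exact Real.exp_le_exp.2 ((le_abs_self _).trans (hχT x)))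
  have h2 : ∫ x, Real.exp (ψ x) ∂ν - ∫ x, Real.exp (u x) ∂ν ≤ Real.exp T * η := by
    rw [← integral_sub (hexpi ψ hψc.measurable hψT) (hexpi u hu hT)]
    calc ∫ x, (Real.exp (ψ x) - Real.exp (u x)) ∂ν ≤ ∫ x, Real.exp T * |u x - ψ x| ∂ν := by
          refine integral_mono ((hexpi ψ hψc.measurable hψT).sub (hexpi u hu hT))
            (((huint ν).sub (hψint ν)).abs.const_mul _) fun x => ?_
          have := abs_exp_sub_exp_le ((le_abs_self _).trans (hψT x)) ((le_abs_self _).trans (hT x))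
          rw [abs_sub_comm (ψ x)] at this
          exact (le_abs_self _).trans this
      _ ≤ Real.exp T * η := by
          rw [integral_const_mul]
          exact mul_le_mul_of_nonneg_left (by linarith) (Real.exp_pos T).le
  refine ⟨ψ, hψc, ?_⟩
  have hη : η + Real.exp T * η = ε := by
    simp only [η]; field_simp
  rw [dualFunctional, dualFunctional]
  linarith

end Variational

/-! ### Entropy as the infimum of the grid entropies -/

lemma dist_le_of_mem_cell {m : ℕ} {i : Fin m} {x y : I} (hx : x ∈ cell m i) (hy : y ∈ cell m i) :
    dist x y ≤ 1 / m := by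
  have h : ((i : ℝ) + 1) / m = i / m + 1 / m := by ring
  rw [Subtype.dist_eq, Real.dist_eq, abs_le]
  have := hx.1; have := hx.2; have := hy.1; have := hy.2
  constructor <;> linarith

/-- A continuous function oscillates little on the squares of a fine grid. -/
lemma eventually_oscillation_square_le {f : I × I → ℝ} (hf : Continuous f) {ε : ℝ} (hε : 0 < ε) :
    ∀ᶠ m : ℕ in atTop, ∀ i j : Fin m, ∀ x ∈ cell m i ×ˢ cell m j, ∀ y ∈ cell m i ×ˢ cell m j,
      |f x - f y| ≤ ε := by
  obtain ⟨δ, hδ, h⟩ := Metric.uniformContinuous_iff.1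
    (CompactSpace.uniformContinuous_of_continuous hf) ε hε
  filter_upwards [eventually_const_div_lt 1 hδ] with m hm i j x hx y hy
  refine (h ?_).le
  rw [Prod.dist_eq]
  exact max_lt ((dist_le_of_mem_cell hx.1 hy.1).trans_lt hm)
    ((dist_le_of_mem_cell hx.2 hy.2).trans_lt hm)

lemma square_nonempty {m : ℕ} (i j : Fin m) : (cell m i ×ˢ cell m j).Nonempty := by
  have : ∀ i : Fin m, (cell m i).Nonempty := fun i => by
    rw [Set.nonempty_iff_ne_empty]
    intro h
    have := volume_cell m i
    rw [h, measure_empty] at this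
    exact ENNReal.natCast_ne_top m (ENNReal.inv_eq_zero.1 this.symm)
  exact (this i).prod (this j)

lemma gridEntropy_eq_sum {μ : Measure (I × I)} (h : UniformMarginals μ) (m : ℕ) [NeZero m] :
    gridEntropy μ m = ∑ i : Fin m, ∑ j : Fin m, ((m : ℝ) ^ 2)⁻¹ *
      Real.negMulLog (μ.real (cell m i ×ˢ cell m j) / ((m : ℝ) ^ 2)⁻¹) := by
  have hm : (m : ℝ) ≠ 0 := by exact_mod_cast NeZero.ne m
  have key : ∀ p : ℝ, ((m : ℝ) ^ 2)⁻¹ * Real.negMulLog (p / ((m : ℝ) ^ 2)⁻¹) =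
      Real.negMulLog p - p * (2 * Real.log m) := fun p => by
    have h2 : Real.negMulLog ((m : ℝ) ^ 2) = -(m : ℝ) ^ 2 * (2 * Real.log m) := by
      rw [Real.negMulLog, Real.log_pow]; push_cast; rfl
    rw [div_inv_eq_mul, Real.negMulLog_mul, h2]
    field_simp
    ring
  simp_rw [key, Finset.sum_sub_distrib, ← Finset.sum_mul, h.sum_sum m, gridEntropy, one_mul]

lemma setIntegral_negMulLog_rnDeriv_le {μ : Measure (I × I)} [IsProbabilityMeasure μ]
    (hμ : μ ≪ volume)
    (hint : Integrable (fun p => Real.negMulLog (μ.rnDeriv volume p).toReal) volume) {m : ℕ}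
    (i j : Fin m) :
    ∫ p in cell m i ×ˢ cell m j, Real.negMulLog (μ.rnDeriv volume p).toReal ≤
      ((m : ℝ) ^ 2)⁻¹ * Real.negMulLog (μ.real (cell m i ×ˢ cell m j) / ((m : ℝ) ^ 2)⁻¹) := by
  have hm : (0 : ℝ) < m := by exact_mod_cast i.pos
  have hvol := volume_real_square m i j
  have hpos : (0 : ℝ) < ((m : ℝ) ^ 2)⁻¹ := by positivity
  have h0 : volume (cell m i ×ˢ cell m j) ≠ 0 := fun h => by
    rw [measureReal_def, h] at hvol
    simp only [ENNReal.toReal_zero] at hvol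
    exact hpos.ne hvol
  have hJ := Real.concaveOn_negMulLog.le_map_set_average Real.continuous_negMulLog.continuousOn
    isClosed_Ici h0 (measure_ne_top _ _)
    (ae_of_all _ fun p => (ENNReal.toReal_nonneg : 0 ≤ (μ.rnDeriv volume p).toReal))
    Measure.integrable_toReal_rnDeriv.integrableOn hint.integrableOn
  rw [setAverage_eq, setAverage_eq, hvol, Measure.setIntegral_toReal_rnDeriv hμ, inv_inv,
    smul_eq_mul, smul_eq_mul] at hJ
  have h2 := mul_le_mul_of_nonneg_left hJ hpos.le
  rw [← mul_assoc, inv_mul_cancel₀ (by positivity), one_mul] at h2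
  rwa [div_inv_eq_mul, mul_comm (μ.real _)]

/-- Discretizing increases the entropy, by Jensen's inequality on each square of the grid. -/
theorem entropy_le_gridEntropy (γ : Permuton) (m : ℕ) [NeZero m] :
    entropy γ ≤ (gridEntropy (γ.1 : Measure (I × I)) m : EReal) := by
  rw [entropy]
  split_ifs with h
  · rw [EReal.coe_le_coe_iff, uniformMarginals_volume.integral_eq_sum m h.2,
      gridEntropy_eq_sum (uniformMarginals γ) m]
    exact Finset.sum_le_sum fun i _ => Finset.sum_le_sum fun j _ =>
      setIntegral_negMulLog_rnDeriv_le h.1 h.2 i j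
  · exact bot_le

/-- For a continuous function the dual functional is at most the relative entropy of the
discretization to a fine enough grid, up to an arbitrarily small error. -/
lemma exists_dualFunctional_le_gridEntropy {μ : Measure (I × I)} (hμ : UniformMarginals μ)
    {f : I × I → ℝ} (hf : Continuous f) {ε : ℝ} (hε : 0 < ε) :
    ∃ m : ℕ, 0 < m ∧ dualFunctional μ volume f ≤ -gridEntropy μ m + 2 * ε := by
  obtain ⟨m, hosc, hm⟩ := ((eventually_oscillation_square_le hf hε).and
    (eventually_gt_atTop 0)).exists
  refine ⟨m, hm, ?_⟩
  have : NeZero m := ⟨hm.ne'⟩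
  have := hμ.isProbabilityMeasure
  have hm' : (0 : ℝ) < m := by exact_mod_cast hm
  obtain ⟨T, hT⟩ := (isCompact_range hf).isBounded.exists_norm_le
  have hfi : ∀ (ρ : Measure (I × I)) [IsFiniteMeasure ρ], Integrable f ρ := fun ρ _ =>
    Integrable.of_bound hf.measurable.aestronglyMeasurable T
      (ae_of_all _ fun x => hT _ ⟨x, rfl⟩)
  have hei : Integrable (fun x => Real.exp (f x)) (volume : Measure (I × I)) :=
    Integrable.of_bound hf.measurable.exp.aestronglyMeasurable (Real.exp T) (ae_of_all _ fun x => by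
      rw [Real.norm_eq_abs, abs_of_pos (Real.exp_pos _)]
      exact Real.exp_le_exp.2 ((le_abs_self _).trans (hT _ ⟨x, rfl⟩)))
  have hcell : ∀ i j : Fin m, ∫ x in cell m i ×ˢ cell m j, f x ∂μ -
      ∫ x in cell m i ×ˢ cell m j, Real.exp (f x) ≤
      -(((m : ℝ) ^ 2)⁻¹ * Real.negMulLog (μ.real (cell m i ×ˢ cell m j) / ((m : ℝ) ^ 2)⁻¹)) -
        μ.real (cell m i ×ˢ cell m j) + 2 * ε * μ.real (cell m i ×ˢ cell m j) := by
    intro i j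
    obtain ⟨y, hy⟩ := square_nonempty i j
    have h1 : ∫ x in cell m i ×ˢ cell m j, f x ∂μ ≤
        (f y + ε) * μ.real (cell m i ×ˢ cell m j) := by
      rw [mul_comm, ← smul_eq_mul, ← setIntegral_const]
      refine setIntegral_mono_on (hfi μ).integrableOn (integrable_const _)
        (measurableSet_square m i j) fun x hx => ?_
      linarith [(abs_le.1 (hosc i j x hx y hy)).2]
    have h2 : Real.exp (f y - ε) * ((m : ℝ) ^ 2)⁻¹ ≤
        ∫ x in cell m i ×ˢ cell m j, Real.exp (f x) := by
      rw [mul_comm, ← volume_real_square m i j, ← smul_eq_mul, ← setIntegral_const]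
      refine setIntegral_mono_on (integrable_const _) hei.integrableOn
        (measurableSet_square m i j) fun x hx => Real.exp_le_exp.2 ?_
      linarith [(abs_le.1 (hosc i j x hx y hy)).1]
    have h3 := mul_sub_exp_mul_le (f y - ε) (measureReal_nonneg (μ := μ)
      (s := cell m i ×ˢ cell m j)) (q := ((m : ℝ) ^ 2)⁻¹) (by positivity)
    linarith
  have hsum := Finset.sum_le_sum fun i (_ : i ∈ Finset.univ) =>
    Finset.sum_le_sum fun j (_ : j ∈ Finset.univ) => hcell i j
  simp only [Finset.sum_add_distrib, Finset.sum_sub_distrib, Finset.sum_neg_distrib,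
    ← Finset.mul_sum _ _ (2 * ε)] at hsum
  rw [← hμ.integral_eq_sum m (hfi μ), ← uniformMarginals_volume.integral_eq_sum m hei,
    ← gridEntropy_eq_sum hμ m, hμ.sum_sum m] at hsum
  rw [dualFunctional]
  linarith

/-- The entropy is the infimum of the grid entropies. -/
theorem exists_gridEntropy_lt {γ : Permuton} {c : ℝ} (hc : entropy γ < c) :
    ∃ m : ℕ, 0 < m ∧ gridEntropy (γ.1 : Measure (I × I)) m < c := by
  set μ := (γ.1 : Measure (I × I))
  by_contra! hcon
  have hbdd : ∀ u : I × I → ℝ, Measurable u → (∃ T, ∀ x, |u x| ≤ T) →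
      dualFunctional μ volume u ≤ -c := by
    rintro u hu ⟨T, hT⟩
    refine le_of_forall_pos_le_add fun ε hε => ?_
    obtain ⟨f, hf, hle⟩ := exists_boundedContinuous_dualFunctional_ge (μ := μ)
      (ν := volume) hu hT (ε := ε / 2) (by positivity)
    obtain ⟨m, hm, hle'⟩ := exists_dualFunctional_le_gridEntropy (uniformMarginals γ) hf
      (ε := ε / 4) (by positivity)
    linarith [hcon m hm]
  have hac : μ ≪ volume := absolutelyContinuous_of_dualFunctional_le hbdd
  have hlin := lintegral_klFun_le_of_dualFunctional_le hac hbdd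
  set g : I × I → ℝ := fun p => (μ.rnDeriv volume p).toReal with hg
  have hgm : Measurable g := (Measure.measurable_rnDeriv μ volume).ennreal_toReal
  have hgi : Integrable g volume := Measure.integrable_toReal_rnDeriv
  have hg1 : ∫ p, g p = 1 := by
    rw [Measure.integral_toReal_rnDeriv hac]; simp
  have hkl0 : ∀ p, 0 ≤ InformationTheory.klFun (g p) := fun p =>
    InformationTheory.klFun_nonneg ENNReal.toReal_nonneg
  have hkm : AEStronglyMeasurable (fun p => InformationTheory.klFun (g p)) volume :=
    (InformationTheory.measurable_klFun.comp hgm).aestronglyMeasurable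
  have hki : Integrable (fun p => InformationTheory.klFun (g p)) volume := by
    refine ⟨hkm, ?_⟩
    rw [hasFiniteIntegral_iff_ofReal (ae_of_all _ hkl0)]
    exact hlin.trans_lt ENNReal.ofReal_lt_top
  have hrel : (fun p => Real.negMulLog (g p)) =
      fun p => 1 - g p - InformationTheory.klFun (g p) := funext fun p => by
    rw [InformationTheory.klFun_apply, Real.negMulLog]; ring
  have h1g : Integrable (fun p => 1 - g p) volume := (integrable_const _).sub hgi
  have hni : Integrable (fun p => Real.negMulLog (g p)) volume := by
    rw [hrel]; exact h1g.sub hki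
  have hval : ∫ p, Real.negMulLog (g p) = -∫ p, InformationTheory.klFun (g p) := by
    rw [hrel, integral_sub h1g hki, integral_sub (integrable_const _) hgi, hg1]
    simp
  have hent : entropy γ = ((∫ p, Real.negMulLog (g p) : ℝ) : EReal) := by
    rw [entropy]
    exact if_pos ⟨hac, hni⟩
  rw [hent, EReal.coe_lt_coe_iff, hval] at hc
  rw [← ofReal_integral_eq_lintegral_ofReal hki (ae_of_all _ hkl0)] at hlin
  -- The zero function shows that the bound `-c` is nonnegative.
  have hc0 : 0 ≤ -c := by
    have := hbdd (fun _ => 0) measurable_const ⟨0, by simp⟩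
    simpa [dualFunctional] using this
  rw [ENNReal.ofReal_le_ofReal_iff hc0] at hlin
  linarith

/-! ### The topology of the space of permutons -/

lemma volume_frontier_cell (m : ℕ) (i : Fin m) : volume (frontier (cell m i)) = 0 := by
  obtain ⟨a, b, -, -, h⟩ := cell_eq_Ioc m i
  rw [h]
  refine measure_mono_null (t := {a, b}) (fun x hx => ?_) (Set.Countable.measure_zero (by simp) _)
  have h1 : x ∈ Set.Icc a b :=
    closure_minimal Set.Ioc_subset_Icc_self isClosed_Icc hx.1
  have h2 : x ∉ Set.Ioo a b := fun h' =>
    hx.2 (interior_maximal Set.Ioo_subset_Ioc_self isOpen_Ioo h')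
  rcases h1.1.eq_or_lt with rfl | h3
  · simp
  rcases h1.2.eq_or_lt with rfl | h4
  · simp
  exact absurd ⟨h3, h4⟩ h2

lemma UniformMarginals.measure_frontier_square {μ : Measure (I × I)} (h : UniformMarginals μ)
    (m : ℕ) (i j : Fin m) : μ (frontier (cell m i ×ˢ cell m j)) = 0 := by
  rw [Set.prod_eq]
  refine null_frontier_inter (measure_mono_null (continuous_fst.frontier_preimage_subset _) ?_)
    (measure_mono_null (continuous_snd.frontier_preimage_subset _) ?_)
  · rw [h.measure_fst_preimage isClosed_frontier.measurableSet, volume_frontier_cell]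
  · rw [h.measure_snd_preimage isClosed_frontier.measurableSet, volume_frontier_cell]

/-- The boundaries of the squares are null sets for every permuton, so that the mass of a square
depends continuously on the permuton. -/
lemma continuous_measure_square (m : ℕ) (i j : Fin m) :
    Continuous fun γ : Permuton => (γ.1 : Measure (I × I)).real (cell m i ×ˢ cell m j) := by
  refine continuous_iff_continuousAt.2 fun γ => ?_
  exact (ENNReal.tendsto_toReal (measure_ne_top _ _)).comp
    (ProbabilityMeasure.tendsto_measure_of_null_frontier_of_tendsto'
      (continuous_subtype_val.tendsto γ) ((uniformMarginals γ).measure_frontier_square m i j))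

lemma continuous_gridEntropy (m : ℕ) :
    Continuous fun γ : Permuton => gridEntropy (γ.1 : Measure (I × I)) m := by
  unfold gridEntropy
  have := continuous_measure_square m
  fun_prop

instance : CompactSpace Permuton := by
  suffices h : IsClosed {γ : ProbabilityMeasure (I × I) |
      (γ : Measure (I × I)).fst = volume ∧ (γ : Measure (I × I)).snd = volume} from
    isCompact_iff_compactSpace.1 h.isCompact
  let V : ProbabilityMeasure I := ⟨volume, inferInstance⟩
  have h1 : IsClosed {γ : ProbabilityMeasure (I × I) |
      γ.map measurable_fst.aemeasurable = V} :=
    isClosed_eq (ProbabilityMeasure.continuous_map continuous_fst) continuous_const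
  have h2 : IsClosed {γ : ProbabilityMeasure (I × I) |
      γ.map measurable_snd.aemeasurable = V} :=
    isClosed_eq (ProbabilityMeasure.continuous_map continuous_snd) continuous_const
  convert h1.inter h2 using 1
  ext γ
  have key : ∀ (f : I × I → I) (hf : AEMeasurable f (γ : Measure (I × I))),
      (γ : Measure (I × I)).map f = volume ↔ γ.map hf = V := fun f hf => by
    rw [← ProbabilityMeasure.toMeasure_injective.eq_iff, ProbabilityMeasure.toMeasure_map]
    rfl
  exact and_congr (key _ _) (key _ _)

lemma UniformMarginals.abs_integral_sub_sum_le {μ : Measure (I × I)} (h : UniformMarginals μ)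
    {m : ℕ} [NeZero m] {f : I × I → ℝ} (hf : Integrable f μ) {ε : ℝ} {c : Fin m → Fin m → ℝ}
    (hc : ∀ i j, ∀ x ∈ cell m i ×ˢ cell m j, |f x - c i j| ≤ ε) :
    |∫ x, f x ∂μ - ∑ i, ∑ j, c i j * μ.real (cell m i ×ˢ cell m j)| ≤ ε := by
  have := h.isProbabilityMeasure
  rw [h.integral_eq_sum m hf, ← Finset.sum_sub_distrib]
  simp_rw [← Finset.sum_sub_distrib]
  calc |∑ i, ∑ j, (∫ x in cell m i ×ˢ cell m j, f x ∂μ - c i j * μ.real (cell m i ×ˢ cell m j))|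
      ≤ ∑ i : Fin m, ∑ j : Fin m, ε * μ.real (cell m i ×ˢ cell m j) := by
        refine (Finset.abs_sum_le_sum_abs _ _).trans (Finset.sum_le_sum fun i _ =>
          (Finset.abs_sum_le_sum_abs _ _).trans (Finset.sum_le_sum fun j _ => ?_))
        have e : ∫ x in cell m i ×ˢ cell m j, f x ∂μ - c i j * μ.real (cell m i ×ˢ cell m j) =
            ∫ x in cell m i ×ˢ cell m j, (f x - c i j) ∂μ := by
          rw [integral_sub hf.integrableOn (integrable_const _), setIntegral_const, smul_eq_mul,
            mul_comm (c i j)]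
        rw [e, ← Real.norm_eq_abs]
        exact norm_setIntegral_le_of_norm_le_const (measure_lt_top _ _) fun x hx => hc i j x hx
    _ = ε := by simp_rw [← Finset.mul_sum]; rw [h.sum_sum m, mul_one]

/-- A sequence of permutons converges as soon as its masses on finer and finer grids approach those
of the limit fast enough. -/
lemma tendsto_of_abs_measure_square_sub_le {γ : Permuton} {γs : ℕ → Permuton}
    (h : ∀ m > 0, ∀ i j : Fin m, |((γs m).1 : Measure (I × I)).real (cell m i ×ˢ cell m j) -
      (γ.1 : Measure (I × I)).real (cell m i ×ˢ cell m j)| ≤ 1 / (m : ℝ) ^ 3) :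
    Tendsto γs atTop (nhds γ) := by
  rw [tendsto_subtype_rng, ProbabilityMeasure.tendsto_iff_forall_integral_tendsto]
  intro f
  rw [Metric.tendsto_atTop']
  intro ε hε
  suffices ∀ᶠ m in atTop, dist (∫ x, f x ∂((γs m).1 : Measure (I × I)))
      (∫ x, f x ∂(γ.1 : Measure (I × I))) < ε by
    obtain ⟨N, hN⟩ := eventually_atTop.1 this
    exact ⟨N, fun n hn => hN n hn.le⟩
  filter_upwards [eventually_oscillation_square_le f.continuous (ε := ε / 4) (by positivity),
    eventually_const_div_lt ‖f‖ (half_pos hε), eventually_gt_atTop 0] with m hosc hm hm0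
  have : NeZero m := ⟨hm0.ne'⟩
  have hm0' : (0 : ℝ) < m := by exact_mod_cast hm0
  choose y hy using fun i j : Fin m => square_nonempty i j
  have key : ∀ ρ : Permuton, |∫ x, f x ∂(ρ.1 : Measure (I × I)) -
      ∑ i, ∑ j, f (y i j) * (ρ.1 : Measure (I × I)).real (cell m i ×ˢ cell m j)| ≤ ε / 4 :=
    fun ρ => (uniformMarginals ρ).abs_integral_sub_sum_le (f.integrable _)
      fun i j x hx => hosc i j x hx _ (hy i j)
  have hdiff : |∑ i, ∑ j, f (y i j) * ((γs m).1 : Measure (I × I)).real (cell m i ×ˢ cell m j) -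
      ∑ i, ∑ j, f (y i j) * (γ.1 : Measure (I × I)).real (cell m i ×ˢ cell m j)| ≤ ‖f‖ / m := by
    rw [← Finset.sum_sub_distrib]
    simp_rw [← Finset.sum_sub_distrib, ← mul_sub]
    refine (abs_sum_sum_fin_le (c := ‖f‖ * (1 / (m : ℝ) ^ 3)) fun i j => ?_).trans
      (le_of_eq (by field_simp))
    rw [abs_mul]
    exact mul_le_mul (f.norm_coe_le_norm _) (h m hm0 i j) (abs_nonneg _) (norm_nonneg _)
  have h1 := abs_le.1 (key (γs m))
  have h2 := abs_le.1 (key γ)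
  have h3 := abs_le.1 hdiff
  rw [Real.dist_eq, abs_lt]
  constructor <;> linarith [h1.1, h1.2, h2.1, h2.2, h3.1, h3.2]

lemma exists_grid_subset_of_isOpen {Λ : Set Permuton} (hΛ : IsOpen Λ) {γ : Permuton} (hγ : γ ∈ Λ) :
    ∃ m : ℕ, 0 < m ∧ ∃ δ > 0, ∀ γ' : Permuton,
      (∀ i j : Fin m, |(γ'.1 : Measure (I × I)).real (cell m i ×ˢ cell m j) -
        (γ.1 : Measure (I × I)).real (cell m i ×ˢ cell m j)| ≤ δ) → γ' ∈ Λ := by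
  by_contra! hcon
  have : ∀ m : ℕ, ∃ γ' : Permuton, γ' ∉ Λ ∧ (0 < m → ∀ i j : Fin m,
      |(γ'.1 : Measure (I × I)).real (cell m i ×ˢ cell m j) -
        (γ.1 : Measure (I × I)).real (cell m i ×ˢ cell m j)| ≤ 1 / (m : ℝ) ^ 3) := by
    intro m
    rcases Nat.eq_zero_or_pos m with rfl | hm
    · obtain ⟨γ', -, h⟩ := hcon 1 one_pos 1 one_pos
      exact ⟨γ', h, fun h => absurd h (lt_irrefl _)⟩
    · obtain ⟨γ', h, h'⟩ := hcon m hm (1 / (m : ℝ) ^ 3) (by positivity)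
      exact ⟨γ', h', fun _ => h⟩
  choose γs hγs hclose using this
  obtain ⟨m, hm⟩ := ((tendsto_of_abs_measure_square_sub_le hclose).eventually
    (hΛ.mem_nhds hγ)).exists
  exact hγs m hm

/-! ### The logarithmic rate -/

lemma logRate_le {Λ : Set Permuton} {n : ℕ} (hn : n ≠ 0) {c : ℝ}
    (h : ((permsIn Λ n).ncard : ℝ) ≤ n ! * Real.exp (n * c)) : logRate Λ n ≤ c := by
  have hn0 : (0 : ℝ) < n := by exact_mod_cast Nat.pos_of_ne_zero hn
  have hf : (0 : ℝ) < n ! := by exact_mod_cast n.factorial_pos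
  rw [logRate]
  rcases Nat.eq_zero_or_pos (permsIn Λ n).ncard with h0 | h0
  · rw [h0, Nat.cast_zero, ENNReal.zero_div, ENNReal.log_zero,
      EReal.coe_mul_bot_of_pos (by positivity)]
    exact bot_le
  · have h0' : (0 : ℝ) < (permsIn Λ n).ncard := by exact_mod_cast h0
    rw [← ENNReal.ofReal_natCast (permsIn Λ n).ncard, ← ENNReal.ofReal_natCast n !,
      ← ENNReal.ofReal_div_of_pos hf, ENNReal.log_ofReal_of_pos (by positivity), ← EReal.coe_mul,
      EReal.coe_le_coe_iff, one_div, inv_mul_le_iff₀ hn0, Real.log_le_iff_le_exp (by positivity),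
      div_le_iff₀ hf, mul_comm]
    exact h

lemma le_logRate {Λ : Set Permuton} {n : ℕ} (hn : n ≠ 0) {c : ℝ}
    (h : n ! * Real.exp (n * c) ≤ ((permsIn Λ n).ncard : ℝ)) : c ≤ logRate Λ n := by
  have hn0 : (0 : ℝ) < n := by exact_mod_cast Nat.pos_of_ne_zero hn
  have hf : (0 : ℝ) < n ! := by exact_mod_cast n.factorial_pos
  have h0 : (0 : ℝ) < (permsIn Λ n).ncard := lt_of_lt_of_le (by positivity) h
  rw [logRate, ← ENNReal.ofReal_natCast (permsIn Λ n).ncard, ← ENNReal.ofReal_natCast n !,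
    ← ENNReal.ofReal_div_of_pos hf, ENNReal.log_ofReal_of_pos (by positivity), ← EReal.coe_mul,
    EReal.coe_le_coe_iff, one_div, le_inv_mul_iff₀ hn0, Real.le_log_iff_exp_le (by positivity),
    le_div_iff₀ hf, mul_comm]
  exact h

/-! ### The upper bound -/

/-- Permutations are sorted into at most `(n+1)^(m²)` classes by their block counts. -/
lemma card_le_pow_mul {m n : ℕ} [NeZero m] (A : Finset (Equiv.Perm (Fin n))) {B : ℝ} (hB0 : 0 ≤ B)
    (hB : ∀ π ∈ A, ((blockClass m π).card : ℝ) ≤ B) :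
    (A.card : ℝ) ≤ (n + 1) ^ (m ^ 2) * B := by
  classical
  let F : Equiv.Perm (Fin n) → Fin m → Fin m → Fin (n + 1) := fun π i j =>
    ⟨blockCount (blockOf m) (blockOf m) π i j, Nat.lt_succ_of_le (blockCount_le π i j)⟩
  have h1 : A.card ≤ ⌊B⌋₊ * (A.image F).card := by
    refine Finset.card_le_mul_card_image A _ fun N hN => ?_
    obtain ⟨π, hπ, rfl⟩ := Finset.mem_image.1 hN
    refine le_trans (Finset.card_le_card fun π' hπ' => ?_) (Nat.le_floor (hB π hπ))
    simp only [blockClass, Finset.mem_filter, Finset.mem_univ, true_and]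
    funext i j
    exact congrArg Fin.val (congrFun (congrFun (Finset.mem_filter.1 hπ').2 i) j)
  have h2 : (A.image F).card ≤ (n + 1) ^ (m ^ 2) := by
    refine (Finset.card_le_univ _).trans (le_of_eq ?_)
    simp only [Fintype.card_fun, Fintype.card_fin]
    rw [← pow_mul, sq]
  calc (A.card : ℝ) ≤ (⌊B⌋₊ : ℝ) * (A.image F).card := by exact_mod_cast h1
    _ ≤ B * (n + 1) ^ (m ^ 2) :=
        mul_le_mul (Nat.floor_le hB0) (by exact_mod_cast h2) (by positivity) hB0
    _ = _ := mul_comm _ _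

lemma eventually_pow_le_exp (k : ℕ) {ε : ℝ} (hε : 0 < ε) :
    ∀ᶠ n : ℕ in atTop, ((n : ℝ) + 1) ^ k ≤ Real.exp (n * ε) := by
  filter_upwards [eventually_mul_log_div_lt k hε, eventually_gt_atTop 0] with n hn hn0
  have hn0' : (0 : ℝ) < n := by exact_mod_cast hn0
  have hn1 : (1 : ℝ) ≤ n := by exact_mod_cast hn0
  rw [div_lt_iff₀ hn0'] at hn
  rw [← Real.log_le_iff_le_exp (by positivity), Real.log_pow]
  have h1 : Real.log ((n : ℝ) + 1) ≤ 1 + Real.log n := by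
    have h2 : Real.log ((n : ℝ) + 1) ≤ Real.log (2 * n) :=
      Real.log_le_log (by positivity) (by linarith)
    rw [Real.log_mul two_ne_zero hn0'.ne'] at h2
    linarith [Real.log_two_lt_d9]
  have := mul_le_mul_of_nonneg_left h1 (Nat.cast_nonneg (α := ℝ) k)
  linarith

/-- The exponential growth rate of the number of permutations in `S`, relative to `n!`, is at most
`c`. -/
def RateLE (c : ℝ) (S : Set Permuton) : Prop :=
  ∀ ε > 0, ∀ᶠ n : ℕ in atTop, ((permsIn S n).ncard : ℝ) ≤ n ! * Real.exp (n * (c + ε))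

lemma permsIn_mono {S T : Set Permuton} (h : S ⊆ T) (n : ℕ) : permsIn S n ⊆ permsIn T n :=
  fun _ ⟨hn, hπ⟩ => ⟨hn, h hπ⟩

lemma rateLE_empty (c : ℝ) : RateLE c ∅ := fun ε _ => Eventually.of_forall fun n => by
  have : permsIn ∅ n = ∅ := Set.eq_empty_iff_forall_notMem.2 fun π hπ => hπ.2
  rw [this, Set.ncard_empty, Nat.cast_zero]
  positivity

lemma RateLE.mono {c : ℝ} {S T : Set Permuton} (hST : S ⊆ T) (hT : RateLE c T) : RateLE c S :=
  fun ε hε => (hT ε hε).mono fun n hn =>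
    le_trans (by exact_mod_cast Set.ncard_le_ncard (permsIn_mono hST n)) hn

lemma RateLE.union {c : ℝ} {S T : Set Permuton} (hS : RateLE c S) (hT : RateLE c T) :
    RateLE c (S ∪ T) := by
  intro ε hε
  filter_upwards [hS (ε / 2) (half_pos hε), hT (ε / 2) (half_pos hε),
    eventually_pow_le_exp 1 (half_pos hε), eventually_gt_atTop 0] with n h1 h2 h3 hn
  have hn1 : (1 : ℝ) ≤ n := by exact_mod_cast hn
  have hsub : permsIn (S ∪ T) n ⊆ permsIn S n ∪ permsIn T n := by
    rintro π ⟨hn, hπ | hπ⟩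
    · exact Or.inl ⟨hn, hπ⟩
    · exact Or.inr ⟨hn, hπ⟩
  have h4 : ((permsIn (S ∪ T) n).ncard : ℝ) ≤ (permsIn S n).ncard + (permsIn T n).ncard := by
    exact_mod_cast (Set.ncard_le_ncard hsub).trans (Set.ncard_union_le _ _)
  have h5 : 2 ≤ Real.exp (n * (ε / 2)) := by rw [pow_one] at h3; linarith
  have h6 : Real.exp (n * (c + ε)) = Real.exp (n * (c + ε / 2)) * Real.exp (n * (ε / 2)) := by
    rw [← Real.exp_add]; ring_nf
  have h7 : (0 : ℝ) ≤ n ! * Real.exp (n * (c + ε / 2)) := by positivity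
  rw [h6, ← mul_assoc]
  nlinarith

lemma card_blockClass_le_exp {m n : ℕ} [NeZero m] (hn : n ≠ 0) {π : Equiv.Perm (Fin n)} {x : ℝ}
    (h : (Real.log (blockClass m π).card - Real.log (n ! : ℝ)) / n ≤ x) :
    ((blockClass m π).card : ℝ) ≤ n ! * Real.exp (n * x) := by
  have hn0 : (0 : ℝ) < n := by exact_mod_cast Nat.pos_of_ne_zero hn
  have hf : (0 : ℝ) < n ! := by exact_mod_cast n.factorial_pos
  have hc : (0 : ℝ) < (blockClass m π).card := by exact_mod_cast blockClass_card_pos m π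
  rw [div_le_iff₀ hn0] at h
  rw [← Real.log_le_log_iff hc (by positivity), Real.log_mul hf.ne' (Real.exp_ne_zero _),
    Real.log_exp]
  linarith

lemma exp_le_card_blockClass {m n : ℕ} [NeZero m] (hn : n ≠ 0) {π : Equiv.Perm (Fin n)} {x : ℝ}
    (h : x ≤ (Real.log (blockClass m π).card - Real.log (n ! : ℝ)) / n) :
    n ! * Real.exp (n * x) ≤ ((blockClass m π).card : ℝ) := by
  have hn0 : (0 : ℝ) < n := by exact_mod_cast Nat.pos_of_ne_zero hn
  have hf : (0 : ℝ) < n ! := by exact_mod_cast n.factorial_pos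
  have hc : (0 : ℝ) < (blockClass m π).card := by exact_mod_cast blockClass_card_pos m π
  rw [le_div_iff₀ hn0] at h
  rw [← Real.log_le_log_iff (by positivity) hc, Real.log_mul hf.ne' (Real.exp_ne_zero _),
    Real.log_exp]
  linarith

/-- The permutons of grid entropy below `c` contain at most `n! e^{cn + o(n)}` permutations: each
block count contributes at most that many, and there are polynomially many block counts. -/
lemma rateLE_gridEntropy_lt (m : ℕ) [NeZero m] (c : ℝ) :
    RateLE c {γ : Permuton | gridEntropy (γ.1 : Measure (I × I)) m < c} := by
  classical
  intro ε hε
  filter_upwards [eventually_log_card_blockClass m (half_pos hε),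
    eventually_pow_le_exp (m ^ 2) (half_pos hε), eventually_ne_atTop 0] with n hclass hpow hn
  set S := {γ : Permuton | gridEntropy (γ.1 : Measure (I × I)) m < c}
  have h1 : ∀ π ∈ (permsIn S n).toFinset,
      ((blockClass m π).card : ℝ) ≤ n ! * Real.exp (n * (c + ε / 2)) := by
    intro π hπ
    obtain ⟨hn', hπ⟩ := Set.mem_toFinset.1 hπ
    have hlt : gridEntropy (permMeasure π) m < c := hπ
    exact card_blockClass_le_exp hn (by linarith [(abs_le.1 (hclass π)).2])
  rw [Set.ncard_eq_toFinset_card']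
  refine (card_le_pow_mul _ (by positivity) h1).trans ?_
  have h6 : Real.exp (n * (c + ε)) = Real.exp (n * (c + ε / 2)) * Real.exp (n * (ε / 2)) := by
    rw [← Real.exp_add]; ring_nf
  calc ((n : ℝ) + 1) ^ (m ^ 2) * (n ! * Real.exp (n * (c + ε / 2)))
      ≤ Real.exp (n * (ε / 2)) * (n ! * Real.exp (n * (c + ε / 2))) := by gcongr
    _ = _ := by rw [h6]; ring

theorem rateLE_of_isClosed {Λ : Set Permuton} (hΛ : IsClosed Λ) {c : ℝ}
    (hc : ∀ γ ∈ Λ, entropy γ < c) : RateLE c Λ := by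
  refine hΛ.isCompact.induction_on (rateLE_empty c) (fun _ _ h => RateLE.mono h)
    (fun _ _ => RateLE.union) fun γ hγ => ?_
  obtain ⟨m, hm, hlt⟩ := exists_gridEntropy_lt (hc γ hγ)
  have : NeZero m := ⟨hm.ne'⟩
  exact ⟨_, mem_nhdsWithin_of_mem_nhds
    ((isOpen_lt (continuous_gridEntropy m) continuous_const).mem_nhds hlt),
    rateLE_gridEntropy_lt m c⟩

/-! ### The lower bound -/

/-- For large `n` some permutation has block counts close to the masses of `γ`; its class lies in
the given neighbourhood of `γ` and has about `n! exp (n H)` elements, with `H ≥ entropy γ` the grid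
entropy of `γ`. -/
theorem eventually_le_logRate {Λ : Set Permuton} (hΛ : IsOpen Λ) {γ : Permuton} (hγ : γ ∈ Λ)
    {c : ℝ} (hc : c < entropy γ) : ∀ᶠ n : ℕ in atTop, c ≤ logRate Λ n := by
  obtain ⟨m, hm, δ, hδ, hsub⟩ := exists_grid_subset_of_isOpen hΛ hγ
  have : NeZero m := ⟨hm.ne'⟩
  have hm0 : (0 : ℝ) < m := by exact_mod_cast hm
  set μ := (γ.1 : Measure (I × I))
  have hgrid : c < gridEntropy μ m := by
    exact_mod_cast hc.trans_le (entropy_le_gridEntropy γ m)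
  set ε : ℝ := (gridEntropy μ m - c) / 2 with hεdef
  have hε : 0 < ε := by rw [hεdef]; linarith
  obtain ⟨δ', hδ', hclose⟩ := exists_negMulLog_close (ε := ε / m ^ 2) (by positivity)
  set K : ℝ := m ^ 2 * (2 * m + 1) + 4 with hK
  filter_upwards [eventually_log_card_blockClass m hε, eventually_const_div_lt K hδ,
    eventually_const_div_lt K hδ', eventually_ne_atTop 0] with n hclass hn1 hn2 hn
  have hn0 : (0 : ℝ) < n := by exact_mod_cast Nat.pos_of_ne_zero hn
  obtain ⟨π₀, hπ₀⟩ := exists_perm_blockCount_near (fun i j => measureReal_nonneg (μ := μ)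
    (s := cell m i ×ˢ cell m j)) ((uniformMarginals γ).sum_row m) ((uniformMarginals γ).sum_col m)
    hn
  have hnear : ∀ π ∈ blockClass m π₀, ∀ i j : Fin m,
      |(permMeasure π).real (cell m i ×ˢ cell m j) - μ.real (cell m i ×ˢ cell m j)| ≤ K / n := by
    intro π hπ i j
    have h1 := abs_permMeasure_real_cell_sub_le π i j
    rw [(Finset.mem_filter.1 hπ).2] at h1
    have h2 : |(blockCount (blockOf m) (blockOf m) π₀ i j : ℝ) / n -
        μ.real (cell m i ×ˢ cell m j)| ≤ m ^ 2 * (2 * m + 1) / n := by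
      rw [show (blockCount (blockOf m) (blockOf m) π₀ i j : ℝ) / n -
        μ.real (cell m i ×ˢ cell m j) = (blockCount (blockOf m) (blockOf m) π₀ i j -
          n * μ.real (cell m i ×ˢ cell m j)) / n by field_simp, abs_div, Nat.abs_cast]
      gcongr
      exact hπ₀ i j
    refine (abs_sub_le _ _ _).trans ((add_le_add h1 h2).trans (le_of_eq ?_))
    rw [hK]; ring
  have hin : (blockClass m π₀ : Set (Equiv.Perm (Fin n))) ⊆ permsIn Λ n := fun π hπ =>
    ⟨hn, hsub (ofPerm hn π) fun i j => (hnear π hπ i j).trans hn1.le⟩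
  have hcard : ((blockClass m π₀).card : ℝ) ≤ (permsIn Λ n).ncard := by
    rw [← Set.ncard_coe_finset]
    exact_mod_cast Set.ncard_le_ncard hin
  have : IsProbabilityMeasure (permMeasure π₀) := (ofPerm hn π₀).1.2
  have hent : |gridEntropy (permMeasure π₀) m - gridEntropy μ m| ≤ m ^ 2 * (ε / m ^ 2) :=
    abs_gridEntropy_sub_le hclose fun i j =>
      (hnear π₀ (mem_blockClass_self m π₀) i j).trans_lt hn2
  rw [mul_div_cancel₀ _ (by positivity)] at hent
  refine le_logRate hn (le_trans (exp_le_card_blockClass hn ?_) hcard)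
  have h1 := (abs_le.1 (hclass π₀)).1
  have h2 := (abs_le.1 hent).1
  have h3 : gridEntropy μ m - 2 * ε = c := by rw [hεdef]; ring
  linarith

end Permuton

theorem theorem1 (Λ : Set Permuton) :
    (IsClosed Λ →
      limsup (fun n : ℕ => Permuton.logRate Λ n) atTop ≤ ⨆ γ ∈ Λ, Permuton.entropy γ) ∧
    (IsOpen Λ →
      ⨆ γ ∈ Λ, Permuton.entropy γ ≤ liminf (fun n : ℕ => Permuton.logRate Λ n) atTop) := by
  refine ⟨fun hΛ => le_of_not_gt fun h => ?_,
    fun hΛ => iSup₂_le fun γ hγ => le_of_not_gt fun h => ?_⟩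
  · obtain ⟨c, hc1, hc2⟩ := EReal.lt_iff_exists_real_btwn.1 h
    obtain ⟨d, hd1, hd2⟩ := EReal.lt_iff_exists_real_btwn.1 hc2
    have hcd : c < d := by exact_mod_cast hd1
    refine hd2.not_ge (limsup_le_of_le (by isBoundedDefault) ?_)
    filter_upwards [Permuton.rateLE_of_isClosed hΛ (c := c)
      (fun γ hγ => (le_iSup₂ (f := fun γ _ => Permuton.entropy γ) γ hγ).trans_lt hc1) (d - c)
      (sub_pos.2 hcd), eventually_ne_atTop 0] with n hn hn0
    exact Permuton.logRate_le hn0 (by simpa using hn)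
  · obtain ⟨c, hc1, hc2⟩ := EReal.lt_iff_exists_real_btwn.1 h
    exact hc1.not_ge (le_liminf_of_le (by isBoundedDefault)
      (Permuton.eventually_le_logRate hΛ hγ hc2))
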